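/- A graphon is a symmetric measurable function $W:[0,1]^2\to[0,1]$; for a finite graph $F$ on $\{1,\dots,k\}$ write $t(F,W)=\int_{[0,1]^k}\prod_{ab\in E(F)}W(x_a,x_b)\,dx$. Random graphons are considered up to weak isomorphism: two random graphons $W,W'$ have the same law, $W\overset{d}{=}W'$, if the families $(t(F,W))_F$ and $(t(F,W'))_F$, indexed by all finite graphs $F$, have the same law. $G(\infty,W)$ is the random graph on $\mathbb N$ obtained from i.i.d. uniform $X_1,X_2,\dots\in[0,1]$ by joining $i<j$ independently with probability $W(X_i,X_j)$. For $0<\alpha<1$ and $\theta>-\alpha$, let $V_1>V_2>\dots$ be the points of the two-parameter Poisson--Dirichlet process $\mathrm{PD}(\alpha,\theta)$, i.e. the ranked values of $Y_\ell\prod_{i<\ell}(1-Y_i)$, $\ell\ge1$, with independent $Y_\ell\sim\mathrm{Beta}(1-\alpha,\theta+\ell\alpha)$, and let $s_k=V_1+\dots+V_k$. For laws $L_H,L_C$ of random graphons, the Poisson--Dirichlet graphon $W_{\mathrm{PD}}(\alpha,\theta,L_H,L_C)$ is defined as follows. Independently of each other, take $(V_\ell)$, i.i.d. random graphons $W_1,W_2,\dots$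 with law $L_C$, and $G(\infty,W_H)$ for a single random graphon $W_H$ with law $L_H$. On $]s_{i-1},s_i[\,\times\,]s_{i-1},s_i[$ place the affinely rescaled copy of $W_i$; on $]s_{i-1},s_i[\,\times\,]s_{j-1},s_j[$ with $i\ne j$ set the value to $1$ if $i$ and $j$ are adjacent in $G(\infty,W_H)$ and to $0$ otherwise; set the value to $0$ elsewhere. The Brownian graphon $W_{\mathrm{Brownian}}$, with law $L_{\mathrm{Brownian}}$, is the random graphon obtained from a standard Brownian excursion $e$ on $[0,1]$ by giving independent fair signs in $\{0,1\}$ to the local minima of $e$ and letting $W(x,y)$ be the sign of the local minimum at which $e$ attains its minimum between $x$ and $y$. Let $L_1=L_{\mathrm{Brownian}}$ be the law of $W^{(1)}=W_{\mathrm{Brownian}}$, and for integers $d\ge2$ define recursively $W^{(d)}=W_{\mathrm{PD}}(2^{-(d-1)},-2^{-d},L_{\mathrm{Brownian}},L_{d-1})$, with $L_d$ the law of $W^{(d)}$. Proposition. For every integer $d\ge2$, as random graphons, $$W^{(d)}\ \overset{d}{=}\ W_{\mathrm{PD}}\bigl(1/2,\,-2^{-d},\,L_{d-1},\,L_{\mathrm{Brownian}}\bigr).$$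 -/

import Mathlib

open MeasureTheory ProbabilityTheory Set
open scoped unitInterval

noncomputable section

namespace PDGraphon

/-! ### Graphons, homomorphism densities, random graphons -/

/-- A graphon: a symmetric measurable function `[0,1]² → [0,1]`. -/
structure Graphon where
  toFun : I → I → ℝ
  measurable_toFun : Measurable (fun p : I × I => toFun p.1 p.2)
  symm_toFun : ∀ x y, toFun x y = toFun y x
  mem_Icc_toFun : ∀ x y, toFun x y ∈ Icc (0 : ℝ) 1

open scoped Classical in
/-- The edges of a graph on `{0, …, k-1}`, each listed once as a pair `a < b`. -/
def edgePairs {k : ℕ} (F : SimpleGraph (Fin k)) : Finset (Fin k × Fin k) :=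
  Finset.univ.filter fun p => p.1 < p.2 ∧ F.Adj p.1 p.2

/-- The homomorphism density `t(F, W) = ∫_{[0,1]^k} ∏_{ab ∈ E(F)} W(x_a, x_b) dx`. -/
def homDensity {k : ℕ} (F : SimpleGraph (Fin k)) (W : Graphon) : ℝ :=
  ∫ x : Fin k → I, ∏ p ∈ edgePairs F, W.toFun (x p.1) (x p.2)

/-- Finite graphs, on the vertex sets `{0, …, k-1}`. -/
abbrev FinGraph : Type := Σ k : ℕ, SimpleGraph (Fin k)

/-- The point `(t(F, W))_F` which encodes a graphon up to weak isomorphism. -/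
def densityVector (W : Graphon) : FinGraph → ℝ := fun F => homDensity F.2 W

/-- A random graphon: a jointly measurable family of graphons over a probability space. -/
structure RandomGraphon where
  Ω : Type
  [mΩ : MeasurableSpace Ω]
  P : Measure Ω
  [isProb : IsProbabilityMeasure P]
  graphon : Ω → Graphon
  measurable_graphon : Measurable (fun p : Ω × I × I => (graphon p.1).toFun p.2.1 p.2.2)

attribute [instance] RandomGraphon.mΩ RandomGraphon.isProb

/-- The law of a random graphon (as a graph limit, i.e. up to weak isomorphism): the law of its
family of homomorphism densities, as a random element of the space of graph limits, which is a
compact subset of the product space `[0,1]^{finite graphs}`. -/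
def RandomGraphon.law (W : RandomGraphon) : Measure (FinGraph → ℝ) :=
  W.P.map fun ω => densityVector (W.graphon ω)

theorem RandomGraphon.measurable_densityVector (W : RandomGraphon) :
    Measurable fun ω => densityVector (W.graphon ω) := by
  refine measurable_pi_lambda _ fun F => ?_
  have h : Measurable (fun q : W.Ω × (Fin F.1 → I) =>
      ∏ p ∈ edgePairs F.2, (W.graphon q.1).toFun (q.2 p.1) (q.2 p.2)) := by
    refine Finset.measurable_prod _ fun p _ => ?_
    exact W.measurable_graphon.comp (f := fun q : W.Ω × (Fin F.1 → I) =>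
      (q.1, q.2 p.1, q.2 p.2)) (by fun_prop)
  exact (h.stronglyMeasurable.integral_prod_right' (ν := volume)).measurable

instance (W : RandomGraphon) : IsProbabilityMeasure W.law :=
  Measure.isProbabilityMeasure_map W.measurable_densityVector.aemeasurable

/-! ### The two-parameter Poisson-Dirichlet process -/

open scoped Classical in
/-- The law `Beta(a, b)`. It is only used for `a, b > 0`. -/
def betaLaw (a b : ℝ) : Measure ℝ := if 0 < a ∧ 0 < b then betaMeasure a b else Measure.dirac 0

instance (a b : ℝ) : IsProbabilityMeasure (betaLaw a b) := by
  unfold betaLaw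
  split_ifs with h
  · exact isProbabilityMeasureBeta h.1 h.2
  · infer_instance

/-- The law of the independent stick-breaking variables `Y_1, Y_2, …`, where `Y_ℓ` has law
`Beta(1 - α, θ + ℓ α)`; the variable `Y_ℓ` is the coordinate with index `ℓ - 1`. -/
def stickLaw (α θ : ℝ) : Measure (ℕ → ℝ) :=
  Measure.infinitePi fun l : ℕ => betaLaw (1 - α) (θ + (l + 1) * α)

instance (α θ : ℝ) : IsProbabilityMeasure (stickLaw α θ) := by
  unfold stickLaw; infer_instance

/-- Stick breaking: `Y_ℓ ∏_{i < ℓ} (1 - Y_i)`. -/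
def stickBreaking (Y : ℕ → ℝ) (l : ℕ) : ℝ := Y l * ∏ i ∈ Finset.range l, (1 - Y i)

/-- The ranked values of a bounded nonnegative sequence: `ranked v 0` is the largest value,
`ranked v 1` the second largest one, and so on (with multiplicities). In general, the value with
index `l` is the supremum, over all sets `S` of `l + 1` indices, of the minimum of `v` on `S`. -/
def ranked (v : ℕ → ℝ) (l : ℕ) : ℝ :=
  ⨆ S : {S : Finset ℕ // S.card = l + 1}, ⨅ i : S.1, v i

/-- The points `V_1 > V_2 > …` of the Poisson-Dirichlet process `PD(α, θ)` as a function of the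
stick-breaking variables, which have law `stickLaw α θ`; the indices start at `0`. -/
def pdPoints (Y : ℕ → ℝ) : ℕ → ℝ := ranked (stickBreaking Y)

/-! ### The Poisson-Dirichlet graphon -/

/-- `s_k`, the sum of the first `k` points. -/
def partialSum (V : ℕ → ℝ) (k : ℕ) : ℝ := ∑ i ∈ Finset.range k, V i

/-- The open interval between the consecutive partial sums `s_i` and `s_{i+1}`, as a subset
of `[0,1]`. -/
def block (V : ℕ → ℝ) (i : ℕ) : Set I :=
  {x | partialSum V i < (x : ℝ) ∧ (x : ℝ) < partialSum V (i + 1)}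

/-- The affine map that takes the interval between `s_i` and `s_{i+1}` to `]0,1[`. -/
def rescale (V : ℕ → ℝ) (i : ℕ) (x : I) : I :=
  projIcc 0 1 zero_le_one (((x : ℝ) - partialSum V i) / V i)

open scoped Classical in
/-- The contribution of the open rectangle `Q_{i,j}`: on `Q_{i,i}` a rescaled copy of the
`i`th graphon, on `Q_{i,j}` with `i ≠ j` the indicator of adjacency of `i` and `j`, and zero
outside of the rectangle. -/
def blockTerm (V : ℕ → ℝ) (W : ℕ → Graphon) (q : SimpleGraph ℕ) (i j : ℕ) (x y : I) : ℝ :=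
  if x ∈ block V i ∧ y ∈ block V j then
    if i = j then (W i).toFun (rescale V i x) (rescale V i y)
    else if q.Adj i j then 1 else 0
  else 0

theorem blockTerm_mem (V : ℕ → ℝ) (W : ℕ → Graphon) (q : SimpleGraph ℕ) (i j : ℕ) (x y : I) :
    blockTerm V W q i j x y ∈ Icc (0 : ℝ) 1 := by
  unfold blockTerm
  split_ifs
  · exact (W i).mem_Icc_toFun _ _
  all_goals simp

theorem blockTerm_symm (V : ℕ → ℝ) (W : ℕ → Graphon) (q : SimpleGraph ℕ) (i j : ℕ) (x y : I) :
    blockTerm V W q i j x y = blockTerm V W q j i y x := by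
  unfold blockTerm
  by_cases hx : x ∈ block V i <;> by_cases hy : y ∈ block V j
  · by_cases h : i = j
    · subst h
      simp only [hx, hy, and_self, if_true]
      exact (W i).symm_toFun _ _
    · have hq : q.Adj i j ↔ q.Adj j i := q.adj_comm i j
      by_cases hi : q.Adj i j <;> simp [hx, hy, h, Ne.symm h, hi, ← hq]
  all_goals simp [hx, hy]

theorem measurable_partialSum {A : Type*} [MeasurableSpace A] {V : A → ℕ → ℝ}
    (hV : ∀ i, Measurable fun a => V a i) (k : ℕ) : Measurable fun a => partialSum (V a) k :=
  Finset.measurable_sum _ fun i _ => hV i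

theorem measurable_blockTerm {A : Type*} [MeasurableSpace A] {V : A → ℕ → ℝ}
    {W : A → ℕ → Graphon} {q : A → SimpleGraph ℕ} (hV : ∀ i, Measurable fun a => V a i)
    (hW : ∀ i, Measurable fun p : A × I × I => (W p.1 i).toFun p.2.1 p.2.2)
    (hq : ∀ i j, MeasurableSet {a | (q a).Adj i j}) (i j : ℕ) :
    Measurable fun p : A × I × I =>
      blockTerm (V p.1) (W p.1) (q p.1) i j p.2.1 p.2.2 := by
  have hs : ∀ k, Measurable fun p : A × I × I => partialSum (V p.1) k := fun k =>
    (measurable_partialSum hV k).comp measurable_fst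
  have hx : Measurable fun p : A × I × I => (p.2.1 : ℝ) := by fun_prop
  have hy : Measurable fun p : A × I × I => (p.2.2 : ℝ) := by fun_prop
  have hVi : Measurable fun p : A × I × I => V p.1 i := (hV i).comp measurable_fst
  unfold blockTerm
  refine Measurable.ite ?_ ?_ measurable_const
  · exact ((measurableSet_lt (hs i) hx).inter (measurableSet_lt hx (hs (i + 1)))).inter
      ((measurableSet_lt (hs j) hy).inter (measurableSet_lt hy (hs (j + 1))))
  · by_cases h : i = j
    · simp only [if_pos h]
      have hr : ∀ f : A × I × I → ℝ, Measurable f → Measurable fun p =>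
          projIcc (0 : ℝ) 1 zero_le_one ((f p - partialSum (V p.1) i) / V p.1 i) :=
        fun f hf => continuous_projIcc.measurable.comp ((hf.sub (hs i)).div hVi)
      exact (hW i).comp (f := fun p : A × I × I =>
        (p.1, rescale (V p.1) i p.2.1, rescale (V p.1) i p.2.2))
        (measurable_fst.prodMk ((hr _ hx).prodMk (hr _ hy)))
    · simp only [if_neg h]
      exact Measurable.ite (measurable_fst (hq i j)) measurable_const measurable_const

/-- The graphon obtained by placing the graphons `W i` in the diagonal squares, with adjacency
between distinct squares given by the graph `q`. The rectangles are pairwise disjoint if the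
numbers `V i` are nonnegative, so that at most one of the terms in the supremum is nonzero. -/
def blockGraphon (V : ℕ → ℝ) (W : ℕ → Graphon) (q : SimpleGraph ℕ) : Graphon where
  toFun x y := ⨆ p : ℕ × ℕ, blockTerm V W q p.1 p.2 x y
  measurable_toFun := by
    refine Measurable.iSup fun p => ?_
    have h := measurable_blockTerm (A := Unit) (V := fun _ => V) (W := fun _ => W)
      (q := fun _ => q) (fun _ => measurable_const)
      (fun i => (W i).measurable_toFun.comp measurable_snd) (fun _ _ => by simp) p.1 p.2
    exact h.comp (f := fun x : I × I => ((), x)) (by fun_prop)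
  symm_toFun x y := by
    rw [← (Equiv.prodComm ℕ ℕ).iSup_comp]
    exact iSup_congr fun p => blockTerm_symm ..
  mem_Icc_toFun x y :=
    ⟨Real.iSup_nonneg fun p => (blockTerm_mem V W q p.1 p.2 x y).1,
      ciSup_le fun p => (blockTerm_mem V W q p.1 p.2 x y).2⟩

/-- The random graph `G(∞, W)`, as a function of independent uniform positions `X` of the
vertices and independent uniform variables `U`: for `i < j` the edge `ij` is present iff
`U (i, j) < W(X_i, X_j)`, which conditionally on `X` has probability `W(X_i, X_j)`. -/
def sampleGraph (W : Graphon) (X : ℕ → I) (U : ℕ × ℕ → I) : SimpleGraph ℕ where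
  Adj i j := i ≠ j ∧ (U (min i j, max i j) : ℝ) < W.toFun (X (min i j)) (X (max i j))
  symm := ⟨fun i j h => by rw [min_comm j i, max_comm j i]; exact ⟨h.1.symm, h.2⟩⟩
  loopless := ⟨fun i h => h.1 rfl⟩

theorem measurable_pdPoints (l : ℕ) : Measurable fun Y : ℕ → ℝ => pdPoints Y l := by
  unfold pdPoints ranked stickBreaking
  refine Measurable.iSup fun S => Measurable.iInf fun i => ?_
  refine (measurable_pi_apply _).mul (Finset.measurable_prod _ fun j _ => ?_)
  exact measurable_const.sub (measurable_pi_apply _)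

/-- The Poisson-Dirichlet graphon `W_PD(α, θ, L_H, L_C)` for `0 < α < 1` and `θ > -α`, where `L_H`
and `L_C` are the laws of the random graphons `H` and `C`. The underlying probability space
carries, independently of each other, the stick-breaking variables of the `PD(α, θ)` process,
an independent sequence of copies of `C`, one copy of `H`, and the uniform variables
that generate `G(∞, H)` given `H`. -/
def poissonDirichlet (α θ : ℝ) (H C : RandomGraphon) : RandomGraphon where
  Ω := (ℕ → ℝ) × (ℕ → C.Ω) × H.Ω × (ℕ → I) × (ℕ × ℕ → I)
  P := (stickLaw α θ).prod ((Measure.infinitePi fun _ : ℕ => C.P).prod (H.P.prod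
    ((Measure.infinitePi fun _ : ℕ => (volume : Measure I)).prod
      (Measure.infinitePi fun _ : ℕ × ℕ => (volume : Measure I)))))
  graphon ω := blockGraphon (pdPoints ω.1) (fun i => C.graphon (ω.2.1 i))
    (sampleGraph (H.graphon ω.2.2.1) ω.2.2.2.1 ω.2.2.2.2)
  measurable_graphon := by
    refine Measurable.iSup fun p => measurable_blockTerm
      (V := fun ω : (ℕ → ℝ) × (ℕ → C.Ω) × H.Ω × (ℕ → I) × (ℕ × ℕ → I) => pdPoints ω.1)
      (W := fun ω i => C.graphon (ω.2.1 i))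
      (q := fun ω => sampleGraph (H.graphon ω.2.2.1) ω.2.2.2.1 ω.2.2.2.2)
      (fun i => (measurable_pdPoints i).comp measurable_fst) (fun i => ?_) (fun i j => ?_) _ _
    · exact C.measurable_graphon.comp
        (f := fun p : ((ℕ → ℝ) × (ℕ → C.Ω) × H.Ω × (ℕ → I) × (ℕ × ℕ → I)) × I × I =>
          (p.1.2.1 i, p.2.1, p.2.2)) (by fun_prop)
    · refine (MeasurableSet.const (i ≠ j)).inter (measurableSet_lt
        (f := fun ω : (ℕ → ℝ) × (ℕ → C.Ω) × H.Ω × (ℕ → I) × (ℕ × ℕ → I) =>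
          (ω.2.2.2.2 (min i j, max i j) : ℝ)) (by fun_prop) ?_)
      exact H.measurable_graphon.comp
        (f := fun ω : (ℕ → ℝ) × (ℕ → C.Ω) × H.Ω × (ℕ → I) × (ℕ × ℕ → I) =>
          (ω.2.2.1, ω.2.2.2.1 (min i j), ω.2.2.2.1 (max i j))) (by fun_prop)

/-! ### The Brownian graphon -/

/-- Lévy's construction of the standard Brownian bridge on `[0,1]` from independent standard
Gaussian variables `z (n, k)`, `k < 2 ^ n`: the sum over `n` and `k` of `z (n, k)` times the
Schauder function that is supported on `[k 2^{-n}, (k+1) 2^{-n}]`, piecewise linear, with its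
peak of height `2^{-n/2} / 2` at the midpoint. At a given `t`, only the term `k = ⌊2^n t⌋`
contributes to level `n`. -/
def bridge (z : ℕ × ℕ → ℝ) (t : ℝ) : ℝ :=
  ∑' n : ℕ, ((√2)⁻¹ ^ n * z (n, ⌊2 ^ n * t⌋₊)) *
    min (Int.fract (2 ^ n * t)) (1 - Int.fract (2 ^ n * t))

/-- The standard Brownian excursion of duration one, as the Bessel bridge of dimension three:
the Euclidean norm of three independent Brownian bridges. -/
def excursion (z : Fin 3 × ℕ × ℕ → ℝ) (t : ℝ) : ℝ :=
  √(∑ c : Fin 3, bridge (fun i => z (c, i)) t ^ 2)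

/-- The minimum of a continuous path `e` on the interval between `x` and `y`, expressed through
the dense set of points that divide the interval in a rational ratio. -/
def pathMin (e : ℝ → ℝ) (x y : ℝ) : ℝ :=
  ⨅ r : {r : ℚ // 0 ≤ r ∧ r ≤ 1}, e ((1 - r.1) * x + r.1 * y)

/-- The `n`th level of the path `e`: its minimum on the `n`th interval, for an enumeration of the
intervals with endpoints in a countable dense subset of `[0,1]`. These are almost surely pairwise
different values for different locations of the minimum, so that the local minima of `e` are
enumerated by their values. -/
def level (e : ℝ → ℝ) (n : ℕ) : ℝ :=
  pathMin e (TopologicalSpace.denseSeq I n.unpair.1) (TopologicalSpace.denseSeq I n.unpair.2)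

/-- The number, in the enumeration, of the local minimum at which `e` attains its minimum between
`x` and `y`: the least index of an interval with the same minimum. -/
def branchIndex (e : ℝ → ℝ) (x y : ℝ) : ℕ := sInf {n | level e n = pathMin e x y}

theorem pathMin_comm (e : ℝ → ℝ) (x y : ℝ) : pathMin e x y = pathMin e y x := by
  unfold pathMin
  let s : {r : ℚ // 0 ≤ r ∧ r ≤ 1} ≃ {r : ℚ // 0 ≤ r ∧ r ≤ 1} :=
    { toFun := fun r => ⟨1 - r.1, by linarith [r.2.2], by linarith [r.2.1]⟩
      invFun := fun r => ⟨1 - r.1, by linarith [r.2.2], by linarith [r.2.1]⟩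
      left_inv := fun r => by simp
      right_inv := fun r => by simp }
  rw [← s.iInf_comp]
  refine iInf_congr fun r => ?_
  congr 1
  simp only [s, Equiv.coe_fn_mk]
  push_cast
  ring

theorem measurable_eval {A ι : Type*} [MeasurableSpace A] [MeasurableSpace ι] [Countable ι]
    [MeasurableSingletonClass ι] {β : Type*} [MeasurableSpace β] {f : A → ι → β} {g : A → ι}
    (hf : ∀ i, Measurable fun a => f a i) (hg : Measurable g) : Measurable fun a => f a (g a) := by
  have h : Measurable fun p : A × ι => f p.1 p.2 := measurable_from_prod_countable_left hf
  exact h.comp (measurable_id.prodMk hg)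

theorem measurable_natInf {A : Type*} [MeasurableSpace A] {p : ℕ → A → Prop}
    (hp : ∀ n, MeasurableSet {a | p n a}) : Measurable fun a => sInf {n | p n a} := by
  refine measurable_of_Iic fun k => ?_
  have h : (fun a => sInf {n | p n a}) ⁻¹' Iic k =
      (⋃ n ∈ Finset.range (k + 1), {a | p n a}) ∪ ⋂ n, {a | p n a}ᶜ := by
    ext a
    simp only [mem_preimage, mem_Iic, Finset.mem_range, mem_union, mem_iUnion, mem_ofPred_eq,
      mem_iInter, mem_compl_iff, exists_prop]
    rcases Set.eq_empty_or_nonempty {n | p n a} with h0 | h0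
    · rw [h0]
      simp only [Nat.sInf_empty, zero_le, true_iff]
      exact Or.inr fun n hn => (Set.ext_iff.1 h0 n).1 hn
    · constructor
      · intro h
        exact Or.inl ⟨_, Nat.lt_succ_of_le h, Nat.sInf_mem h0⟩
      · rintro (⟨n, hn, hpn⟩ | h)
        · exact (Nat.sInf_le hpn).trans (Nat.le_of_lt_succ hn)
        · exact absurd h0.some_mem (h _)
  rw [h]
  exact ((Finset.range (k + 1)).measurableSet_biUnion fun n _ => hp n).union
    (MeasurableSet.iInter fun n => (hp n).compl)

theorem measurable_bridge {A : Type*} [MeasurableSpace A] {z : A → ℕ × ℕ → ℝ} {t : A → ℝ}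
    (hz : ∀ i, Measurable fun a => z a i) (ht : Measurable t) :
    Measurable fun a => bridge (z a) (t a) := by
  unfold bridge
  refine Measurable.tsum fun n => ?_
  have h2 : Measurable fun a => 2 ^ n * t a := ht.const_mul _
  refine Measurable.mul (Measurable.mul measurable_const ?_)
    (Measurable.min h2.fract (measurable_const.sub h2.fract))
  exact measurable_eval (f := fun a k => z a (n, k)) (fun k => hz _) h2.nat_floor

theorem measurable_excursion {A : Type*} [MeasurableSpace A] {z : A → Fin 3 × ℕ × ℕ → ℝ}
    {t : A → ℝ} (hz : ∀ i, Measurable fun a => z a i) (ht : Measurable t) :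
    Measurable fun a => excursion (z a) (t a) := by
  unfold excursion
  refine Measurable.sqrt (Finset.measurable_sum _ fun c _ => Measurable.pow_const ?_ 2)
  exact measurable_bridge (fun i => hz _) ht

theorem measurable_branchIndex {A : Type*} [MeasurableSpace A] {z : A → Fin 3 × ℕ × ℕ → ℝ}
    {x y : A → ℝ} (hz : ∀ i, Measurable fun a => z a i) (hx : Measurable x) (hy : Measurable y) :
    Measurable fun a => branchIndex (excursion (z a)) (x a) (y a) := by
  have h : ∀ x y : A → ℝ, Measurable x → Measurable y →
      Measurable fun a => pathMin (excursion (z a)) (x a) (y a) := fun x y hx hy =>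
    Measurable.iInf fun r => measurable_excursion hz ((hx.const_mul _).add (hy.const_mul _))
  exact measurable_natInf fun n =>
    measurableSet_eq_fun (h _ _ measurable_const measurable_const) (h x y hx hy)

/-- The fair coin flip. -/
def coin : Measure Bool := (PMF.uniformOfFintype Bool).toMeasure

instance : IsProbabilityMeasure coin := by unfold coin; infer_instance

theorem measurable_sign {A : Type*} [MeasurableSpace A] {z : A → Fin 3 × ℕ × ℕ → ℝ}
    {ε : A → ℕ → Bool} {x y : A → ℝ} (hz : ∀ i, Measurable fun a => z a i)
    (hε : ∀ i, Measurable fun a => ε a i) (hx : Measurable x) (hy : Measurable y) :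
    Measurable fun a =>
      if ε a (branchIndex (excursion (z a)) (x a) (y a)) = true then (1 : ℝ) else 0 := by
  have h := measurable_eval hε (measurable_branchIndex hz hx hy)
  exact Measurable.ite (h (measurableSet_singleton true)) measurable_const measurable_const

/-- The Brownian graphon. Given a Brownian excursion `e`, its local minima receive independent
signs by fair coin flips, and `W(x, y)` is `1` or `0` according to the sign of the local minimum
at which `e` attains its minimum between `x` and `y`. -/
def brownian : RandomGraphon where
  Ω := (Fin 3 × ℕ × ℕ → ℝ) × (ℕ → Bool)
  P := (Measure.infinitePi fun _ : Fin 3 × ℕ × ℕ => gaussianReal 0 1).prod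
    (Measure.infinitePi fun _ : ℕ => coin)
  graphon ω :=
    { toFun := fun x y => if ω.2 (branchIndex (excursion ω.1) x y) = true then 1 else 0
      measurable_toFun := measurable_sign (A := I × I) (z := fun _ => ω.1) (ε := fun _ => ω.2)
        (fun _ => measurable_const) (fun _ => measurable_const) (by fun_prop) (by fun_prop)
      symm_toFun := fun x y => by unfold branchIndex; rw [pathMin_comm _ (x : ℝ) y]
      mem_Icc_toFun := fun x y => by split_ifs <;> simp }
  measurable_graphon := measurable_sign (fun _ => by fun_prop) (fun _ => by fun_prop)
    (by fun_prop) (by fun_prop)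

/-! ### The iterated limits -/

/-- The random graphons `W^{(d)}` for `d ≥ 1` (the value at `d = 0` is not used):
`W^{(1)}` is the Brownian graphon, and
`W^{(d)} = W_PD(2^{-(d-1)}, -2^{-d}, L_Brownian, L_{d-1})` for `d ≥ 2`,
with `L_{d-1}` the law of `W^{(d-1)}`. -/
def iteratedLimit : ℕ → RandomGraphon
  | 0 => brownian
  | 1 => brownian
  | d + 2 => poissonDirichlet ((1 / 2) ^ (d + 1)) (-(1 / 2) ^ (d + 2)) brownian
      (iteratedLimit (d + 1))

end PDGraphon

end

open MeasureTheory ProbabilityTheory Set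
open scoped unitInterval

noncomputable section

namespace PDGraphon

/-! ### Homomorphism densities for graphs on arbitrary finite vertex types -/

/-! The law of a random graphon is determined by its expected homomorphism densities. Densities lie
in [0,1], and the density of a disjoint union of graphs is the product of the densities, so the
expected densities already contain all joint moments (`law_eq_of_meanDensity_eq`).

For a Poisson–Dirichlet graphon these expectations are finite sums. Sample the vertices of F and
partition them according to the block they fall into. Given the partition π, the edges inside a
block see an independent copy of C, while the edges between blocks only test whether the contracted
graph F/π occurs in G(∞, H). Hence (`meanDensity_poissonDirichlet`) E t(F) = Σ_π p(π) · E t(F/π, H)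
· ∏_{B ∈ π} E t(F[B], C), where p is the exchangeable partition probability function `eppf α θ`. Its
closed form is obtained from stick breaking by splitting off the first stick
(`toReal_stickMoment_eq_eppf`).

The theorem is an instance of an associativity law (`law_poissonDirichlet_assoc`): W_PD(αβ, θ, A,
W_PD(α, −αβ, B, C)) and W_PD(α, θ, W_PD(β, θ/α, A, B), C) have the same law. Expanding each side
twice gives a sum over pairs of nested partitions. On the left the coarse partition comes first and
is refined; on the right the fine one comes first and is coarsened. The densities of A, B, C agree
term by term (`pdTerm_comp`), and the weights agree by the duality of fragmentation and coagulation
for the partition probability functions (`eppf_fragmentation`).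

The recursion follows by induction on d: the induction hypothesis rewrites the inner graphon
L_{d-1}, and associativity moves the Brownian graphon from the innermost place to the outer one. No
property of the Brownian graphon is used. -/

open scoped Classical in
/-- The product of the weights of the edges of a graph. -/
def edgeProd {V : Type} [Fintype V] (G : SimpleGraph V) (w : Sym2 V → ℝ) : ℝ :=
  ∏ e : G.edgeSet, w e

theorem edgeProd_mem {V : Type} [Fintype V] (G : SimpleGraph V) {w : Sym2 V → ℝ}
    (h : ∀ e, w e ∈ Icc (0 : ℝ) 1) : edgeProd G w ∈ Icc (0 : ℝ) 1 :=
  ⟨Finset.prod_nonneg fun e _ => (h e).1, Finset.prod_le_one (fun e _ => (h e).1) fun e _ => (h e).2⟩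

theorem measurable_edgeProd {A V : Type} [MeasurableSpace A] [Fintype V] (G : SimpleGraph V)
    {w : A → Sym2 V → ℝ} (h : ∀ e, Measurable fun a => w a e) :
    Measurable fun a => edgeProd G (w a) := by
  classical
  exact Finset.measurable_prod _ fun e _ => h e

theorem edgeProd_iso {V V' : Type} [Fintype V] [Fintype V'] {G : SimpleGraph V}
    {G' : SimpleGraph V'} (φ : G ≃g G') (w : Sym2 V' → ℝ) :
    edgeProd G (fun e => w (e.map φ)) = edgeProd G' w := by
  classical
  exact Fintype.prod_equiv φ.mapEdgeSet _ _ fun _ => rfl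

theorem edgeProd_sum {V V' : Type} [Fintype V] [Fintype V'] (G : SimpleGraph V)
    (G' : SimpleGraph V') (w : Sym2 (V ⊕ V') → ℝ) :
    edgeProd (G ⊕g G') w =
      edgeProd G (fun e => w (e.map Sum.inl)) * edgeProd G' (fun e => w (e.map Sum.inr)) := by
  classical
  unfold edgeProd
  refine Eq.trans ?_ (Fintype.prod_sum_type fun e : G.edgeSet ⊕ G'.edgeSet =>
    w (e.elim (fun e => e.1.map Sum.inl) (fun e => e.1.map Sum.inr)))
  refine (Fintype.prod_equiv SimpleGraph.edgeSetSumEquiv.symm _ _ ?_).symm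
  rintro (⟨⟨a, b⟩, h⟩ | ⟨⟨a, b⟩, h⟩) <;> rfl

/-- `edgePairs` refers to the order of `Fin k`, which isomorphisms do not respect. Unordered pairs
make densities invariant under relabelling and meaningful on fibers and quotients. -/
theorem edgeProd_eq_prod_edgePairs {k : ℕ} (F : SimpleGraph (Fin k)) (w : Sym2 (Fin k) → ℝ) :
    edgeProd F w = ∏ p ∈ edgePairs F, w s(p.1, p.2) := by
  classical
  unfold edgeProd
  symm
  refine Finset.prod_bij (fun p hp => ⟨s(p.1, p.2), ?_⟩) (fun _ _ => Finset.mem_univ _) ?_ ?_ ?_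
  · simpa using (Finset.mem_filter.1 hp).2.2
  · rintro ⟨a, b⟩ ha ⟨c, d⟩ hc h
    have h1 := (Finset.mem_filter.1 ha).2.1
    have h2 := (Finset.mem_filter.1 hc).2.1
    simp only [Subtype.mk.injEq, Sym2.eq_iff] at h
    rcases h with ⟨rfl, rfl⟩ | ⟨rfl, rfl⟩
    · rfl
    · exact absurd h1 h2.not_gt
  · rintro ⟨e, he⟩ -
    induction e with
    | h a b =>
      have hab : F.Adj a b := he
      rcases lt_or_gt_of_ne hab.ne with h | h
      · exact ⟨(a, b), by simp [edgePairs, h, hab], rfl⟩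
      · exact ⟨(b, a), by simp [edgePairs, h, hab.symm], Subtype.ext Sym2.eq_swap⟩
  · intros; rfl

/-- A graphon as a function of unordered pairs. -/
def Graphon.edge (W : Graphon) : Sym2 I → ℝ := Sym2.lift ⟨W.toFun, W.symm_toFun⟩

@[simp] theorem Graphon.edge_mk (W : Graphon) (x y : I) : W.edge s(x, y) = W.toFun x y := rfl

theorem Graphon.edge_mem (W : Graphon) (e : Sym2 I) : W.edge e ∈ Icc (0 : ℝ) 1 := by
  induction e with
  | h a b => exact W.mem_Icc_toFun a b

theorem RandomGraphon.measurable_edge {A V : Type} [MeasurableSpace A] (W : RandomGraphon)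
    {f : A → W.Ω} {x : A → V → I} (hf : Measurable f) (hx : ∀ a, Measurable fun p => x p a)
    (e : Sym2 V) : Measurable fun p => (W.graphon (f p)).edge (e.map (x p)) := by
  induction e with
  | h a b =>
    exact W.measurable_graphon.comp (f := fun p => (f p, x p a, x p b))
      (hf.prodMk ((hx a).prodMk (hx b)))

theorem Graphon.measurable_edge {A V : Type} [MeasurableSpace A] (W : Graphon)
    {x : A → V → I} (hx : ∀ a, Measurable fun p => x p a)
    (e : Sym2 V) : Measurable fun p => W.edge (e.map (x p)) := by
  induction e with
  | h a b =>
    exact W.measurable_toFun.comp (f := fun p => (x p a, x p b)) ((hx a).prodMk (hx b))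

/-- The homomorphism density of a graph on an arbitrary finite vertex type. -/
def density {V : Type} [Fintype V] (G : SimpleGraph V) (W : Graphon) : ℝ :=
  ∫ x : V → I, edgeProd G fun e => W.edge (e.map x)

theorem homDensity_eq_density {k : ℕ} (F : SimpleGraph (Fin k)) (W : Graphon) :
    homDensity F W = density F W := by
  unfold homDensity density
  simp_rw [edgeProd_eq_prod_edgePairs]
  rfl

theorem integral_mem_Icc {A : Type} [MeasurableSpace A] (μ : Measure A) [IsProbabilityMeasure μ]
    {f : A → ℝ} (h : ∀ a, f a ∈ Icc (0 : ℝ) 1) : ∫ a, f a ∂μ ∈ Icc (0 : ℝ) 1 := by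
  refine ⟨integral_nonneg fun a => (h a).1, ?_⟩
  by_cases hf : Integrable f μ
  · refine (integral_mono hf (integrable_const 1) fun a => (h a).2).trans ?_
    simp
  · rw [integral_undef hf]; exact zero_le_one

theorem integrable_of_mem_Icc {A : Type} [MeasurableSpace A] {μ : Measure A}
    [IsFiniteMeasure μ] {f : A → ℝ} (hf : Measurable f) (h : ∀ a, f a ∈ Icc (0 : ℝ) 1) :
    Integrable f μ :=
  Integrable.of_mem_Icc 0 1 hf.aemeasurable (ae_of_all _ h)

theorem density_mem {V : Type} [Fintype V] (G : SimpleGraph V) (W : Graphon) :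
    density G W ∈ Icc (0 : ℝ) 1 :=
  integral_mem_Icc _ fun _ => edgeProd_mem G fun _ => W.edge_mem _

theorem density_iso {V V' : Type} [Fintype V] [Fintype V'] {G : SimpleGraph V}
    {G' : SimpleGraph V'} (φ : G ≃g G') (W : Graphon) : density G W = density G' W := by
  unfold density
  have h := (volume_measurePreserving_piCongrLeft (fun _ : V' => I) φ.toEquiv)
  rw [← h.integral_comp' (g := fun x : V' → I => edgeProd G' fun e => W.edge (e.map x))]
  refine integral_congr_ae (ae_of_all _ fun x => ?_)
  simp only
  rw [← edgeProd_iso φ]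
  congr 1
  funext e
  rw [Sym2.map_map]
  congr 2
  funext a
  exact (Equiv.piCongrLeft_apply_apply (fun _ : V' => I) φ.toEquiv x a).symm

/-- The two vertex sets are sampled independently. This multiplicativity is what makes expected
densities a moment-determining family. -/
theorem density_sum {V V' : Type} [Fintype V] [Fintype V'] (G : SimpleGraph V)
    (G' : SimpleGraph V') (W : Graphon) : density (G ⊕g G') W = density G W * density G' W := by
  unfold density
  rw [← integral_prod_mul]
  have h := (volume_measurePreserving_sumPiEquivProdPi (fun _ : V ⊕ V' => I)).symm
  rw [← h.integral_comp']
  refine integral_congr_ae (ae_of_all _ fun x => ?_)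
  simp only [edgeProd_sum, Sym2.map_map]
  rfl

/-- The expected homomorphism density. -/
def meanDensity {V : Type} [Fintype V] (G : SimpleGraph V) (W : RandomGraphon) : ℝ :=
  ∫ ω, density G (W.graphon ω) ∂W.P

theorem RandomGraphon.measurable_density {A V : Type} [MeasurableSpace A] [Fintype V]
    (G : SimpleGraph V) (W : RandomGraphon) {f : A → W.Ω} (hf : Measurable f) :
    Measurable fun a => density G (W.graphon (f a)) := by
  have h : Measurable fun q : A × (V → I) =>
      edgeProd G fun e => (W.graphon (f q.1)).edge (e.map q.2) :=
    measurable_edgeProd G fun e => W.measurable_edge (hf.comp measurable_fst) (by fun_prop) e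
  exact (h.stronglyMeasurable.integral_prod_right' (ν := volume)).measurable

theorem meanDensity_iso {V V' : Type} [Fintype V] [Fintype V'] {G : SimpleGraph V}
    {G' : SimpleGraph V'} (φ : G ≃g G') (W : RandomGraphon) :
    meanDensity G W = meanDensity G' W :=
  integral_congr_ae (ae_of_all _ fun _ => density_iso φ _)

theorem exists_fin_iso {V : Type} [Fintype V] (G : SimpleGraph V) :
    ∃ F : FinGraph, Nonempty (G ≃g F.2) :=
  ⟨⟨Fintype.card V, G.map (Fintype.equivFin V)⟩, ⟨SimpleGraph.Iso.map (Fintype.equivFin V) G⟩⟩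

theorem meanDensity_eq_integral_law (W : RandomGraphon) (F : FinGraph) :
    meanDensity F.2 W = ∫ x, x F ∂W.law := by
  unfold RandomGraphon.law meanDensity
  rw [integral_map W.measurable_densityVector.aemeasurable
    (measurable_pi_apply F).aestronglyMeasurable]
  exact integral_congr_ae (ae_of_all _ fun _ => (homDensity_eq_density _ _).symm)

/-- The converse of `law_eq_of_meanDensity_eq`, for arbitrary vertex types; it allows a random
graphon to be replaced by another with the same law. -/
theorem meanDensity_eq_of_law_eq {V : Type} [Fintype V] (G : SimpleGraph V)
    {W W' : RandomGraphon} (h : W.law = W'.law) : meanDensity G W = meanDensity G W' := by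
  obtain ⟨F, ⟨φ⟩⟩ := exists_fin_iso G
  rw [meanDensity_iso φ, meanDensity_iso φ, meanDensity_eq_integral_law,
    meanDensity_eq_integral_law, h]

/-! ### The law of a random graphon is determined by the expected densities -/

/-- Method of moments on a compact cube: the algebra generated by the coordinates separates points
and, as a vector space, is spanned by monomials, which are the products over lists. -/
theorem measure_ext_of_prod_integrals {ι : Type} [Countable ι] {μ ν : Measure (ι → I)}
    [IsProbabilityMeasure μ] [IsProbabilityMeasure ν]
    (h : ∀ l : List ι, ∫ x, (l.map fun i => (x i : ℝ)).prod ∂μ =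
      ∫ x, (l.map fun i => (x i : ℝ)).prod ∂ν) : μ = ν := by
  let ev : ι → BoundedContinuousFunction (ι → I) ℝ := fun i =>
    BoundedContinuousFunction.mkOfCompact ⟨fun x => (x i : ℝ), by fun_prop⟩
  let A : StarSubalgebra ℝ (BoundedContinuousFunction (ι → I) ℝ) :=
    { Algebra.adjoin ℝ (range ev) with
      star_mem' := fun {a} ha => by
        rwa [show star a = a by ext x; simp] }
  refine ext_of_forall_mem_subalgebra_integral_eq_of_polish (𝕜 := ℝ) (A := A) ?_ ?_
  · intro x y hxy
    obtain ⟨i, hi⟩ := Function.ne_iff.1 hxy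
    refine ⟨ev i, ⟨(ev i).toContinuousMap, ⟨ev i, ?_, rfl⟩, rfl⟩, ?_⟩
    · exact Algebra.subset_adjoin (mem_range_self i)
    · exact fun h => hi (Subtype.ext h)
  · intro g hg
    have hg' : g ∈ Submodule.span ℝ (Submonoid.closure (range ev) : Set _) := by
      rw [← Algebra.adjoin_eq_span]; exact hg
    clear hg
    induction hg' using Submodule.span_induction with
    | mem g hg =>
      obtain ⟨l, hl, rfl⟩ := Submonoid.exists_list_of_mem_closure hg
      obtain ⟨l', rfl⟩ := (Set.range_list_map ev).symm.subset hl
      have hprod : ∀ x, (l'.map ev).prod x = (l'.map fun i => (x i : ℝ)).prod := by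
        intro x
        clear hl hg
        induction l' with
        | nil => rfl
        | cons i l ih =>
          simp only [List.map_cons, List.prod_cons, BoundedContinuousFunction.mul_apply, ih]
          rfl
      simp_rw [hprod]
      exact h l'
    | zero => simp
    | add f g _ _ hf hg =>
      simp only [BoundedContinuousFunction.add_apply]
      rw [integral_add (f.integrable _) (g.integrable _),
        integral_add (f.integrable _) (g.integrable _), hf, hg]
    | smul c f _ hf =>
      simp only [BoundedContinuousFunction.coe_smul, integral_smul, hf]

theorem exists_density_eq_list_prod (l : List FinGraph) :
    ∃ F : FinGraph, ∀ W : Graphon,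
      density F.2 W = (l.map fun F => density F.2 W).prod := by
  induction l with
  | nil =>
    -- The graph without vertices has density 1, the empty product.
    refine ⟨⟨0, ⊥⟩, fun W => ?_⟩
    unfold density edgeProd
    simp
  | cons F l ih =>
    obtain ⟨F', h⟩ := ih
    obtain ⟨F'', ⟨φ⟩⟩ := exists_fin_iso (F.2 ⊕g F'.2)
    exact ⟨F'', fun W => by rw [← density_iso φ, density_sum, h]; simp⟩

/-- The densities as an element of a compact space. -/
def unitDensityVector (W : Graphon) (F : FinGraph) : I :=
  ⟨density F.2 W, density_mem F.2 W⟩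

/-- Every monomial in the densities is itself a density, by disjoint unions, so equality of means
gives equality of all joint moments. -/
theorem law_eq_of_meanDensity_eq {W W' : RandomGraphon}
    (h : ∀ F : FinGraph, meanDensity F.2 W = meanDensity F.2 W') : W.law = W'.law := by
  have hm : ∀ W : RandomGraphon, Measurable fun ω => unitDensityVector (W.graphon ω) := fun W =>
    measurable_pi_lambda _ fun F => (W.measurable_density F.2 measurable_id).subtype_mk
  have hlaw : ∀ W : RandomGraphon, W.law =
      (W.P.map fun ω => unitDensityVector (W.graphon ω)).map fun x F => (x F : ℝ) := by
    intro W
    rw [Measure.map_map (by fun_prop) (hm W)]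
    unfold RandomGraphon.law
    congr 1
    funext ω F
    exact homDensity_eq_density _ _
  have hP : ∀ W : RandomGraphon,
      IsProbabilityMeasure (W.P.map fun ω => unitDensityVector (W.graphon ω)) := fun W =>
    Measure.isProbabilityMeasure_map (hm W).aemeasurable
  have := hP W
  have := hP W'
  rw [hlaw, hlaw]
  congr 1
  refine measure_ext_of_prod_integrals fun l => ?_
  obtain ⟨F, hF⟩ := exists_density_eq_list_prod l
  have key : ∀ W : RandomGraphon,
      ∫ x, (l.map fun i => (x i : ℝ)).prod ∂(W.P.map fun ω => unitDensityVector (W.graphon ω)) =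
        meanDensity F.2 W := by
    intro W
    rw [integral_map (hm W).aemeasurable]
    · exact integral_congr_ae (ae_of_all _ fun ω => (hF _).symm)
    · refine Continuous.aestronglyMeasurable ?_
      exact continuous_list_prod l fun i _ => by fun_prop
  rw [key, key, h]

/-! ### Factorization of edge products along a partition of the vertices -/

/-- The fiber of a map. -/
@[ext] structure Fiber {V Q : Type} (p : V → Q) (b : Q) : Type where
  val : V
  prop : p val = b

theorem Fiber.val_injective {V Q : Type} (p : V → Q) (b : Q) :
    (Fiber.val : Fiber p b → V).Injective := fun _ _ h => Fiber.ext h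

instance {V Q : Type} [Finite V] (p : V → Q) (b : Q) : Finite (Fiber p b) :=
  Finite.of_injective _ (Fiber.val_injective p b)

instance {V Q : Type} [Finite V] (p : V → Q) (b : Q) : Fintype (Fiber p b) := Fintype.ofFinite _

/-- The graph induced on a fiber of a map. -/
def fiberGraph {V Q : Type} (p : V → Q) (b : Q) (F : SimpleGraph V) :
    SimpleGraph (Fiber p b) := F.comap Fiber.val

open scoped Classical in
theorem edgeProd_ite {V : Type} [Fintype V] (G : SimpleGraph V) (P : Sym2 V → Prop) :
    edgeProd G (fun e => if P e then 1 else 0) = if ∀ e ∈ G.edgeSet, P e then 1 else 0 := by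
  unfold edgeProd
  rw [Finset.prod_ite_zero]
  simp

open scoped Classical in
/-- The indicator function of the edge set of a graph. -/
def edgeInd {V : Type} (G : SimpleGraph V) (e : Sym2 V) : ℝ := if e ∈ G.edgeSet then 1 else 0

theorem edgeInd_mem {V : Type} (G : SimpleGraph V) (e : Sym2 V) :
    edgeInd G e ∈ Icc (0 : ℝ) 1 := by
  unfold edgeInd; split_ifs <;> simp

/-- Edges inside fibers are grouped by fiber. Between fibers the weights are 0 or 1 and depend only
on the pair of fibers, so parallel edges collapse to one edge of `F.map p`: such weights are
idempotent. -/
theorem edgeProd_eq_prod_fiber {V Q : Type} [Fintype V] [Fintype Q] (p : V → Q)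
    (F : SimpleGraph V) (w w' : Sym2 V → ℝ) (w'' : Sym2 Q → Prop) [DecidablePred w'']
    (h1 : ∀ a b, F.Adj a b → p a = p b → w s(a, b) = w' s(a, b))
    (h2 : ∀ a b, F.Adj a b → p a ≠ p b →
      (w'' s(p a, p b) ∧ w s(a, b) = 1) ∨ (¬ w'' s(p a, p b) ∧ w s(a, b) = 0)) :
    edgeProd F w = (∏ b, edgeProd (fiberGraph p b F) fun e => w' (e.map Fiber.val)) *
      edgeProd (F.map p) fun e => if w'' e then 1 else 0 := by
  classical
  have hr : edgeProd (F.map p) (fun e => if w'' e then (1 : ℝ) else 0) =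
      if ∀ e ∈ (F.map p).edgeSet, w'' e then 1 else 0 := by
    have h := edgeProd_ite (F.map p) w''
    convert h
  rw [hr]
  unfold edgeProd
  rw [← Finset.prod_filter_mul_prod_filter_not Finset.univ
    fun e : F.edgeSet => (e.1.map p).IsDiag]
  congr 1
  · refine Eq.trans ?_ (Finset.prod_sigma Finset.univ (fun b => Finset.univ)
      fun x : (b : Q) × (fiberGraph p b F).edgeSet => w' (x.2.1.map Fiber.val))
    symm
    refine Finset.prod_bij (fun x _ => ⟨x.2.1.map Fiber.val, ?_⟩) ?_ ?_ ?_ ?_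
    · obtain ⟨b, ⟨e, he⟩⟩ := x
      induction e with
      | h x y => exact he
    · rintro ⟨b, ⟨e, he⟩⟩ -
      induction e with
      | h x y => simp [x.prop, y.prop]
    · rintro ⟨b, ⟨e, he⟩⟩ _ ⟨b', ⟨e', he'⟩⟩ _ h
      have h' := congrArg Subtype.val h
      simp only at h'
      obtain rfl : b = b' := by
        induction e with
        | h x y =>
          induction e' with
          | h x' y' =>
            simp only [Sym2.map_mk, Sym2.eq_iff] at h'
            rcases h' with h' | h'
            · rw [← x.prop, h'.1, x'.prop]
            · rw [← x.prop, h'.1, y'.prop]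
      obtain rfl : e = e' := Sym2.map.injective (Fiber.val_injective p b) h'
      rfl
    · rintro ⟨e, he⟩ h
      induction e with
      | h x y =>
        have hxy : p x = p y := by simpa using (Finset.mem_filter.1 h).2
        exact ⟨⟨p y, ⟨s(⟨x, hxy⟩, ⟨y, rfl⟩), he⟩⟩, by simp, rfl⟩
    · rintro ⟨b, ⟨e, he⟩⟩ -
      induction e with
      | h x y => exact (h1 x.val y.val he (x.prop.trans y.prop.symm)).symm
  · split_ifs with h
    · refine Finset.prod_eq_one ?_
      rintro ⟨e, he⟩ hd
      induction e with
      | h x y =>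
        have hxy : p x ≠ p y := by simpa using (Finset.mem_filter.1 hd).2
        have := h s(p x, p y) ⟨hxy, x, y, he, rfl, rfl⟩
        rcases h2 x y he hxy with h3 | h3
        · exact h3.2
        · exact absurd this h3.1
    · push Not at h
      obtain ⟨e, he, hw⟩ := h
      induction e with
      | h P R =>
        obtain ⟨hne, x, y, hxy, h3, h4⟩ := he
        dsimp only at h3 h4 hne
        subst h3 h4
        refine Finset.prod_eq_zero (i := (⟨s(x, y), hxy⟩ : F.edgeSet)) (by simpa using hne) ?_
        rcases h2 x y hxy hne with h3 | h3
        · exact absurd h3.1 hw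
        · exact h3.2

open scoped Classical in
/-- The weight of a pair of vertices with colors `c` and positions `u` within their blocks. -/
def colorEdge {V : Type} (W : ℕ → Graphon) (q : SimpleGraph ℕ) (c : V → ℕ) (u : V → I) :
    Sym2 V → ℝ :=
  Sym2.lift ⟨fun a b => if c a = c b then (W (c a)).toFun (u a) (u b)
    else if q.Adj (c a) (c b) then 1 else 0, fun a b => by
      beta_reduce
      by_cases h : c a = c b
      · rw [if_pos h, if_pos h.symm, h, (W (c b)).symm_toFun]
      · rw [if_neg h, if_neg (Ne.symm h), q.adj_comm]⟩

theorem colorEdge_mem {V : Type} (W : ℕ → Graphon) (q : SimpleGraph ℕ) (c : V → ℕ) (u : V → I)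
    (e : Sym2 V) : colorEdge W q c u e ∈ Icc (0 : ℝ) 1 := by
  induction e with
  | h a b =>
    simp only [colorEdge, Sym2.lift_mk]
    split_ifs
    · exact (W _).mem_Icc_toFun _ _
    all_goals simp

theorem measurable_colorEdge {A V : Type} [MeasurableSpace A] (W : ℕ → Graphon)
    (q : SimpleGraph ℕ) (c : V → ℕ) {u : A → V → I} (hu : ∀ a, Measurable fun p => u p a)
    (e : Sym2 V) : Measurable fun p => colorEdge W q c (u p) e := by
  induction e with
  | h a b =>
    simp only [colorEdge, Sym2.lift_mk]
    split_ifs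
    · exact (W (c a)).measurable_toFun.comp (f := fun p => (u p a, u p b)) ((hu a).prodMk (hu b))
    all_goals exact measurable_const

theorem edgeProd_colorEdge {V Q : Type} [Fintype V] [Fintype Q] (F : SimpleGraph V) (p : V → Q)
    {ι : Q → ℕ} (hι : ι.Injective) (W : ℕ → Graphon) (q : SimpleGraph ℕ) (u : V → I) :
    edgeProd F (colorEdge W q (ι ∘ p) u) =
      (∏ b, edgeProd (fiberGraph p b F) fun e => (W (ι b)).edge (e.map fun a => u a.val)) *
      edgeProd (F.map p) fun e => edgeInd q (e.map ι) := by
  classical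
  rw [edgeProd_eq_prod_fiber p F (colorEdge W q (ι ∘ p) u)
    (Sym2.lift ⟨fun a b => if p a = p b then (W (ι (p a))).toFun (u a) (u b) else 0,
      fun a b => by
        beta_reduce
        by_cases h : p a = p b
        · rw [if_pos h, if_pos h.symm, h, (W _).symm_toFun]
        · rw [if_neg h, if_neg (Ne.symm h)]⟩) (fun e => e.map ι ∈ q.edgeSet)]
  · congr 1
    refine Finset.prod_congr rfl fun b _ => ?_
    congr 1
    funext e
    induction e with
    | h x y => simp [x.prop, y.prop]
  · intro a b hab h
    simp [colorEdge, h]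
  · intro a b hab h
    have : ι (p a) ≠ ι (p b) := fun h' => h (hι h')
    by_cases hq : q.Adj (ι (p a)) (ι (p b))
    · left; simp [colorEdge, this, hq]
    · right; simp [colorEdge, this, hq]

/-! ### Densities of block graphons -/

/-- The law of the index of the block that contains a uniform point. -/
def colorLaw (V : ℕ → ℝ) : Measure ℕ := Measure.sum fun i => ENNReal.ofReal (V i) • Measure.dirac i

theorem colorLaw_singleton (V : ℕ → ℝ) (i : ℕ) : colorLaw V {i} = ENNReal.ofReal (V i) := by
  rw [colorLaw, Measure.sum_apply _ (measurableSet_singleton i), tsum_eq_single i]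
  · simp
  · intro j hj
    simp [hj]

theorem isProbabilityMeasure_colorLaw {V : ℕ → ℝ} (h0 : ∀ i, 0 ≤ V i) (h1 : HasSum V 1) :
    IsProbabilityMeasure (colorLaw V) := by
  refine ⟨?_⟩
  rw [colorLaw, Measure.sum_apply _ MeasurableSet.univ]
  simp only [Measure.smul_apply, measure_univ, smul_eq_mul, mul_one]
  rw [← ENNReal.ofReal_tsum_of_nonneg h0 h1.summable, h1.tsum_eq, ENNReal.ofReal_one]

/-- The point at relative position `u` in the block with index `i`. -/
def blockPoint (V : ℕ → ℝ) (p : ℕ × I) : I :=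
  projIcc 0 1 zero_le_one (partialSum V p.1 + V p.1 * p.2)

theorem measurable_blockPoint (V : ℕ → ℝ) : Measurable (blockPoint V) := by
  refine measurable_from_prod_countable_right fun i => ?_
  exact continuous_projIcc.measurable.comp
    (f := fun u : I => partialSum V i + V i * u) (by fun_prop)

section

variable {V : ℕ → ℝ}

theorem partialSum_le_one (h0 : ∀ i, 0 ≤ V i) (h1 : HasSum V 1) (k : ℕ) : partialSum V k ≤ 1 :=
  sum_le_hasSum _ (fun i _ => h0 i) h1

theorem partialSum_nonneg (h0 : ∀ i, 0 ≤ V i) (k : ℕ) : 0 ≤ partialSum V k :=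
  Finset.sum_nonneg fun i _ => h0 i

theorem partialSum_succ (V : ℕ → ℝ) (k : ℕ) : partialSum V (k + 1) = partialSum V k + V k :=
  Finset.sum_range_succ _ _

theorem coe_blockPoint (h0 : ∀ i, 0 ≤ V i) (h1 : HasSum V 1) (i : ℕ) (u : I) :
    (blockPoint V (i, u) : ℝ) = partialSum V i + V i * u := by
  have h2 := partialSum_le_one h0 h1 (i + 1)
  rw [partialSum_succ] at h2
  have h3 := partialSum_nonneg h0 i
  have h4 := mul_nonneg (h0 i) u.2.1
  have h5 := mul_le_of_le_one_right (h0 i) u.2.2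
  rw [blockPoint, coe_projIcc, min_eq_right (by linarith), max_eq_right (by linarith)]

theorem blockPoint_mem_block (h0 : ∀ i, 0 < V i) (h1 : HasSum V 1) (i : ℕ) {u : I}
    (hu : (u : ℝ) ∈ Ioo (0 : ℝ) 1) : blockPoint V (i, u) ∈ block V i := by
  have h2 := mul_pos (h0 i) hu.1
  have h3 := mul_lt_of_lt_one_right (h0 i) hu.2
  simp only [block, mem_ofPred_eq, coe_blockPoint (fun i => (h0 i).le) h1, partialSum_succ]
  constructor <;> linarith

theorem rescale_blockPoint (h0 : ∀ i, 0 < V i) (h1 : HasSum V 1) (i : ℕ) (u : I) :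
    rescale V i (blockPoint V (i, u)) = u := by
  rw [rescale, coe_blockPoint (fun i => (h0 i).le) h1, add_sub_cancel_left,
    mul_div_cancel_left₀ _ (h0 i).ne', projIcc_val]

theorem monotone_partialSum (h0 : ∀ i, 0 ≤ V i) : Monotone (partialSum V) :=
  monotone_nat_of_le_succ fun k => by rw [partialSum_succ]; linarith [h0 k]

theorem eq_of_mem_block (h0 : ∀ i, 0 ≤ V i) {i j : ℕ} {x : I} (hi : x ∈ block V i)
    (hj : x ∈ block V j) : i = j := by
  by_contra h
  rcases lt_or_gt_of_ne h with h | h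
  · exact absurd (hi.2.trans_le (monotone_partialSum h0 h)) hj.1.not_gt
  · exact absurd (hj.2.trans_le (monotone_partialSum h0 h)) hi.1.not_gt

theorem blockGraphon_apply (h0 : ∀ i, 0 ≤ V i) (W : ℕ → Graphon) (q : SimpleGraph ℕ) {i j : ℕ}
    {x y : I} (hx : x ∈ block V i) (hy : y ∈ block V j) :
    (blockGraphon V W q).toFun x y = blockTerm V W q i j x y := by
  refine le_antisymm (ciSup_le fun p => ?_)
    (le_ciSup (f := fun p : ℕ × ℕ => blockTerm V W q p.1 p.2 x y)
      ⟨1, by rintro _ ⟨p, rfl⟩; exact (blockTerm_mem V W q p.1 p.2 x y).2⟩ (i, j))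
  by_cases h : x ∈ block V p.1 ∧ y ∈ block V p.2
  · rw [eq_of_mem_block h0 h.1 hx, eq_of_mem_block h0 h.2 hy]
  · refine le_of_eq_of_le ?_ (blockTerm_mem V W q i j x y).1
    rw [blockTerm, if_neg h]

theorem blockGraphon_edge (h0 : ∀ i, 0 < V i) (h1 : HasSum V 1) {A : Type} (W : ℕ → Graphon)
    (q : SimpleGraph ℕ) (c : A → ℕ) {u : A → I} (hu : ∀ a, (u a : ℝ) ∈ Ioo (0 : ℝ) 1)
    (e : Sym2 A) :
    (blockGraphon V W q).edge (e.map fun a => blockPoint V (c a, u a)) = colorEdge W q c u e := by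
  induction e with
  | h a b =>
    have ha := blockPoint_mem_block h0 h1 (c a) (hu a)
    have hb := blockPoint_mem_block h0 h1 (c b) (hu b)
    simp only [Sym2.map_mk, Graphon.edge_mk, colorEdge, Sym2.lift_mk]
    rw [blockGraphon_apply (fun i => (h0 i).le) W q ha hb, blockTerm, if_pos ⟨ha, hb⟩,
      rescale_blockPoint h0 h1]
    split_ifs with h
    · rw [h, rescale_blockPoint h0 h1]
    all_goals rfl

theorem ae_mem_Ioo : ∀ᵐ u : I, (u : ℝ) ∈ Ioo (0 : ℝ) 1 := by
  have h0 : ∀ᵐ u : I, u ≠ 0 := by simp [ae_iff]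
  have h1 : ∀ᵐ u : I, u ≠ 1 := by simp [ae_iff]
  filter_upwards [h0, h1] with u h0 h1
  exact ⟨unitInterval.pos_iff_ne_zero.2 h0, unitInterval.lt_one_iff_ne_one.2 h1⟩

theorem measurableSet_block (V : ℕ → ℝ) (i : ℕ) : MeasurableSet (block V i) :=
  (measurableSet_lt measurable_const measurable_subtype_coe).inter
    (measurableSet_lt measurable_subtype_coe measurable_const)

theorem volume_restrict_block (h0 : ∀ i, 0 < V i) (h1 : HasSum V 1) (i : ℕ) :
    (volume : Measure I).restrict (block V i) =
      ENNReal.ofReal (V i) • volume.map fun u : I => blockPoint V (i, u) := by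
  have hb := measurableSet_block V i
  have hp : Measurable fun u : I => blockPoint V (i, u) :=
    (measurable_blockPoint V).comp (by fun_prop)
  have h0' : ∀ i, 0 ≤ V i := fun i => (h0 i).le
  ext s hs
  have hi : MeasurableSet ((Subtype.val : I → ℝ) '' (s ∩ block V i)) :=
    (MeasurableEmbedding.subtype_coe measurableSet_Icc).measurableSet_image.2 (hs.inter hb)
  -- Pulling back to ℝ lets the scaling and translation behaviour of Lebesgue measure apply; the
  -- open interval appears because blocks are open, and its endpoints are null (`hc`).
  have key : (fun u : ℝ => V i * u) ⁻¹' ((fun u : ℝ => partialSum V i + u) ⁻¹'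
      ((Subtype.val : I → ℝ) '' (s ∩ block V i))) =
      Subtype.val '' ((fun u : I => blockPoint V (i, u)) ⁻¹' s ∩ {u : I | (u : ℝ) ∈ Ioo 0 1}) := by
    ext t
    constructor
    · rintro ⟨x, ⟨hx, hx1, hx2⟩, h⟩
      rw [partialSum_succ] at hx2
      simp only at h
      have ht0 : 0 < t := by
        by_contra h'
        nlinarith [h0 i]
      have ht1 : t < 1 := by
        by_contra h'
        nlinarith [h0 i]
      refine ⟨⟨t, ht0.le, ht1.le⟩, ⟨?_, ht0, ht1⟩, rfl⟩
      have : blockPoint V (i, ⟨t, ht0.le, ht1.le⟩) = x :=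
        Subtype.ext (by rw [coe_blockPoint h0' h1, h])
      rw [mem_preimage, this]
      exact hx
    · rintro ⟨u, ⟨hu, hu1⟩, rfl⟩
      exact ⟨_, ⟨hu, blockPoint_mem_block h0 h1 i hu1⟩, coe_blockPoint h0' h1 i u⟩
  have hc : volume ((fun u : I => blockPoint V (i, u)) ⁻¹' s ∩ {u : I | (u : ℝ) ∈ Ioo 0 1}) =
      volume ((fun u : I => blockPoint V (i, u)) ⁻¹' s) := by
    refine measure_congr (Filter.EventuallyEq.symm ?_)
    filter_upwards [ae_mem_Ioo] with u hu
    exact propext ⟨fun h => ⟨h, hu⟩, fun h => h.1⟩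
  rw [Measure.restrict_apply hs, Measure.smul_apply, Measure.map_apply hp hs, ← hc,
    unitInterval.volume_apply, unitInterval.volume_apply, ← key,
    Real.volume_preimage_mul_left (h0 i).ne', measure_preimage_add, abs_of_pos (inv_pos.2 (h0 i)),
    smul_eq_mul, ← mul_assoc, ← ENNReal.ofReal_mul (h0' i), mul_inv_cancel₀ (h0 i).ne',
    ENNReal.ofReal_one, one_mul]

/-- A uniform point is obtained by choosing a block with probability its length and then an
independent uniform relative position. Disjointness of the blocks gives an inequality of measures
and equal total mass forces equality, so it need not be shown separately that the blocks cover
almost everything. -/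
theorem map_blockPoint (h0 : ∀ i, 0 < V i) (h1 : HasSum V 1) :
    ((colorLaw V).prod volume).map (blockPoint V) = (volume : Measure I) := by
  have := isProbabilityMeasure_colorLaw (fun i => (h0 i).le) h1
  have hb := measurableSet_block V
  have hsum : ((colorLaw V).prod volume).map (blockPoint V) =
      Measure.sum fun i => (volume : Measure I).restrict (block V i) := by
    ext s hs
    have hp : MeasurableSet (blockPoint V ⁻¹' s) := measurable_blockPoint V hs
    rw [Measure.map_apply (measurable_blockPoint V) hs, Measure.prod_apply hp,
      Measure.sum_apply _ hs, colorLaw, lintegral_sum_measure]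
    refine tsum_congr fun i => ?_
    have hm : Measurable fun u : I => blockPoint V (i, u) :=
      (measurable_blockPoint V).comp (by fun_prop)
    rw [lintegral_smul_measure, lintegral_dirac, volume_restrict_block h0 h1,
      Measure.smul_apply, Measure.map_apply hm hs]
    rfl
  have hle : Measure.sum (fun i => (volume : Measure I).restrict (block V i)) ≤ volume := by
    rw [← Measure.restrict_iUnion (fun i j hij => Set.disjoint_left.2 fun x hi hj =>
      hij (eq_of_mem_block (fun i => (h0 i).le) hi hj)) hb]
    exact Measure.restrict_le_self
  rw [hsum]
  have : IsFiniteMeasure (Measure.sum fun i => (volume : Measure I).restrict (block V i)) :=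
    isFiniteMeasure_of_le _ hle
  refine Measure.eq_of_le_of_measure_univ_eq hle ?_
  rw [← hsum, Measure.map_apply (measurable_blockPoint V) MeasurableSet.univ]
  simp

/-- By `map_blockPoint` the sampled points become independent colors and positions. The formula for
the weights fails only if some position is 0 or 1, which is a null event. -/
theorem density_blockGraphon (h0 : ∀ i, 0 < V i) (h1 : HasSum V 1) {A : Type} [Fintype A]
    (F : SimpleGraph A) (W : ℕ → Graphon) (q : SimpleGraph ℕ) :
    density F (blockGraphon V W q) =
      ∫ c : A → ℕ, (∫ u : A → I, edgeProd F (colorEdge W q c u))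
        ∂(Measure.pi fun _ : A => colorLaw V) := by
  have := isProbabilityMeasure_colorLaw (fun i => (h0 i).le) h1
  have hm : ∀ c : A → ℕ, Measurable fun u : A → I => edgeProd F (colorEdge W q c u) := fun c =>
    measurable_edgeProd F fun e => measurable_colorEdge W q c (fun a => by fun_prop) e
  have hpi : MeasurePreserving (fun (y : A → ℕ × I) a => blockPoint V (y a))
      (Measure.pi fun _ => (colorLaw V).prod volume) (volume : Measure (A → I)) :=
    measurePreserving_pi _ _ fun _ => ⟨measurable_blockPoint V, map_blockPoint h0 h1⟩
  have hpr := (measurePreserving_arrowProdEquivProdArrow ℕ I A (fun _ => colorLaw V)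
    fun _ => volume).symm
  have hmb : Measurable fun x : A → I => edgeProd F fun e => (blockGraphon V W q).edge (e.map x) :=
    measurable_edgeProd F fun e => (blockGraphon V W q).measurable_edge (fun a => by fun_prop) e
  have hmu : Measurable fun y : (A → ℕ) × (A → I) => edgeProd F (colorEdge W q y.1 y.2) :=
    measurable_from_prod_countable_right hm
  have hmap : density F (blockGraphon V W q) =
      ∫ y, edgeProd F fun e => (blockGraphon V W q).edge (e.map fun a => blockPoint V (y.1 a, y.2 a))
        ∂((Measure.pi fun _ : A => colorLaw V).prod (volume : Measure (A → I))) := by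
    have h := integral_map (μ := Measure.pi fun _ => (colorLaw V).prod volume)
      hpi.measurable.aemeasurable hmb.aestronglyMeasurable
    rw [hpi.map_eq, ← hpr.integral_comp'] at h
    exact h
  rw [hmap]
  have hae : ∀ᵐ y : (A → ℕ) × (A → I) ∂((Measure.pi fun _ : A => colorLaw V).prod volume),
      ∀ a, (y.2 a : ℝ) ∈ Ioo (0 : ℝ) 1 := by
    refine Measure.quasiMeasurePreserving_snd.ae (p := fun y : A → I =>
      ∀ a, (y a : ℝ) ∈ Ioo (0 : ℝ) 1) ?_
    rw [ae_all_iff]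
    intro a
    exact (Measure.quasiMeasurePreserving_eval (fun _ : A => (volume : Measure I)) a).ae ae_mem_Ioo
  calc _ = ∫ y, edgeProd F (colorEdge W q y.1 y.2)
        ∂((Measure.pi fun _ : A => colorLaw V).prod (volume : Measure (A → I))) := by
        refine integral_congr_ae ?_
        filter_upwards [hae] with y hy
        congr 1
        funext e
        exact blockGraphon_edge h0 h1 W q y.1 hy e
    _ = _ := by
        rw [integral_prod _ (integrable_of_mem_Icc hmu fun y =>
            edgeProd_mem F fun e => colorEdge_mem W q _ _ e)]

theorem integral_pi_colorLaw (h0 : ∀ i, 0 ≤ V i) (h1 : HasSum V 1) {A : Type} [Fintype A]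
    {f : (A → ℕ) → ℝ} (hf : ∀ c, f c ∈ Icc (0 : ℝ) 1) :
    ∫ c, f c ∂(Measure.pi fun _ : A => colorLaw V) = ∑' c : A → ℕ, (∏ a, V (c a)) * f c := by
  have := isProbabilityMeasure_colorLaw h0 h1
  rw [integral_countable (integrable_of_mem_Icc (measurable_of_countable _) hf)]
  refine tsum_congr fun c => ?_
  rw [measureReal_def, Measure.pi_singleton, ENNReal.toReal_prod]
  simp_rw [colorLaw_singleton, ENNReal.toReal_ofReal (h0 _)]
  rfl

end

/-! ### Expected densities of a block graphon with random blocks and a sampled graph -/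

/-- Injectivity means that no coordinate is read twice, so the selected coordinates remain
independent. -/
theorem map_infinitePi_comp_injective {Ω κ Q : Type} [MeasurableSpace Ω] [Fintype Q]
    (μ : Measure Ω) [IsProbabilityMeasure μ] {ι : Q → κ} (hι : ι.Injective) :
    MeasurePreserving (fun (x : κ → Ω) b => x (ι b)) (Measure.infinitePi fun _ => μ)
      (Measure.pi fun _ => μ) := by
  classical
  have hm : Measurable fun (x : κ → Ω) b => x (ι b) := by fun_prop
  refine ⟨hm, (Measure.pi_eq fun s hs => ?_).symm⟩
  rw [Measure.map_apply hm (MeasurableSet.univ_pi hs)]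
  have h : (fun (x : κ → Ω) b => x (ι b)) ⁻¹' (univ.pi s) =
      Set.pi (Finset.univ.image ι : Finset κ) (Function.extend ι s fun _ => univ) := by
    ext x
    simp [Set.mem_pi, hι.extend_apply]
  rw [h, Measure.infinitePi_pi, Finset.prod_image fun a _ b _ h => hι h]
  · simp [hι.extend_apply]
  · intro i hi
    obtain ⟨b, -, rfl⟩ := Finset.mem_image.1 hi
    rw [hι.extend_apply]
    exact hs b

theorem integral_prod_infinitePi {Ω κ Q : Type} [MeasurableSpace Ω] [Fintype Q]
    (μ : Measure Ω) [IsProbabilityMeasure μ] {ι : Q → κ} (hι : ι.Injective) {f : Q → Ω → ℝ}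
    (hf : ∀ b, Measurable (f b)) :
    ∫ x : κ → Ω, ∏ b, f b (x (ι b)) ∂(Measure.infinitePi fun _ => μ) =
      ∏ b, ∫ x, f b x ∂μ := by
  have hm := map_infinitePi_comp_injective μ hι
  rw [← integral_fintype_prod_eq_prod, ← hm.map_eq, integral_map hm.measurable.aemeasurable]
  exact (Finset.measurable_prod _ fun b _ => (hf b).comp (measurable_pi_apply b)).aestronglyMeasurable

theorem measurePreserving_glue {V Q : Type} [Fintype V] [Fintype Q] (p : V → Q) :
    MeasurePreserving (fun (z : ∀ b, Fiber p b → I) a => z (p a) ⟨a, rfl⟩) volume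
      (volume : Measure (V → I)) := by
  classical
  have hm : Measurable fun (z : ∀ b, Fiber p b → I) a => z (p a) ⟨a, rfl⟩ := by fun_prop
  refine ⟨hm, (Measure.pi_eq fun s hs => ?_).symm⟩
  rw [Measure.map_apply hm (MeasurableSet.univ_pi hs)]
  have h : (fun (z : ∀ b, Fiber p b → I) a => z (p a) ⟨a, rfl⟩) ⁻¹' (univ.pi s) =
      univ.pi fun b => univ.pi fun a : Fiber p b => s a.val := by
    ext z
    simp only [mem_preimage, mem_univ_pi]
    constructor
    · rintro h b ⟨a, rfl⟩
      exact h a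
    · exact fun h a => h (p a) ⟨a, rfl⟩
  rw [h, volume_pi, Measure.pi_pi]
  simp_rw [volume_pi, Measure.pi_pi]
  rw [← Fintype.prod_sigma' fun b (a : Fiber p b) => volume (s a.val)]
  exact Fintype.prod_bijective (fun x : (b : Q) × Fiber p b => x.2.val)
    ⟨fun ⟨b, a⟩ ⟨b', a'⟩ h => by
      obtain ⟨a, rfl⟩ := a
      obtain ⟨a', rfl⟩ := a'
      obtain rfl : a = a' := h
      rfl, fun a => ⟨⟨p a, a, rfl⟩, rfl⟩⟩ _ _ fun _ => rfl

theorem integral_prod_fiber {V Q : Type} [Fintype V] [Fintype Q] (p : V → Q)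
    {g : ∀ b, (Fiber p b → I) → ℝ} (hg : ∀ b, Measurable (g b)) :
    ∫ u : V → I, ∏ b, g b (fun a => u a.val) = ∏ b, ∫ x, g b x := by
  have hm := measurePreserving_glue p
  have h := integral_fintype_prod_volume_eq_prod (𝕜 := ℝ) g
  rw [← h, ← hm.map_eq, integral_map hm.measurable.aemeasurable]
  · refine integral_congr_ae (ae_of_all _ fun z => Finset.prod_congr rfl fun b _ => ?_)
    congr 1
    funext a
    obtain ⟨a, rfl⟩ := a
    rfl
  · refine Measurable.aestronglyMeasurable ?_
    exact Finset.measurable_prod _ fun b _ => (hg b).comp (by fun_prop)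

/-- Given the colors, positions in different blocks are independent, and edges between blocks do not
involve positions at all. -/
theorem integral_colorEdge {V Q : Type} [Fintype V] [Fintype Q] (F : SimpleGraph V) (p : V → Q)
    {ι : Q → ℕ} (hι : ι.Injective) (W : ℕ → Graphon) (q : SimpleGraph ℕ) :
    ∫ u : V → I, edgeProd F (colorEdge W q (ι ∘ p) u) =
      (∏ b, density (fiberGraph p b F) (W (ι b))) *
      edgeProd (F.map p) fun e => edgeInd q (e.map ι) := by
  simp_rw [edgeProd_colorEdge F p hι, integral_mul_const]
  congr 1
  exact integral_prod_fiber p (g := fun b x => edgeProd (fiberGraph p b F) fun e =>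
    (W (ι b)).edge (e.map x)) fun b =>
      measurable_edgeProd _ fun e => (W (ι b)).measurable_edge (fun a => by fun_prop) e

theorem integral_indicator_lt {w : ℝ} (hw : w ∈ Icc (0 : ℝ) 1) :
    ∫ u : I, (if (u : ℝ) < w then (1 : ℝ) else 0) = w := by
  have h : (fun u : I => if (u : ℝ) < w then (1 : ℝ) else 0) =
      (Iio (⟨w, hw⟩ : I)).indicator fun _ => 1 := by
    funext u
    simp [Set.indicator, ← Subtype.coe_lt_coe]
  rw [h, integral_indicator_const _ measurableSet_Iio, measureReal_def]
  simp [hw.1]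

/-- The weight of an unordered pair in the sampled graph is determined by the sorted pair. -/
theorem edgeInd_sampleGraph (W : Graphon) (X : ℕ → I) (U : ℕ × ℕ → I) {e : Sym2 ℕ}
    (he : ¬ e.IsDiag) : edgeInd (sampleGraph W X U) e =
      if (U (Sym2.sortEquiv e).1 : ℝ) < W.edge (e.map X) then 1 else 0 := by
  classical
  induction e with
  | h i j =>
    have hij : i ≠ j := by simpa using he
    have h1 : (Sym2.sortEquiv s(i, j)).1 = (min i j, max i j) := rfl
    have h2 : W.toFun (X (min i j)) (X (max i j)) = W.toFun (X i) (X j) := by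
      rcases le_total i j with h | h
      · rw [min_eq_left h, max_eq_right h]
      · rw [min_eq_right h, max_eq_left h, W.symm_toFun]
    simp only [edgeInd, SimpleGraph.mem_edgeSet, sampleGraph, h1, Sym2.map_mk, Graphon.edge_mk, h2,
      ne_eq, hij, not_false_eq_true, true_and]

/-- Each edge reads its own uniform variable, since sorting is injective on unordered pairs; hence
the edge indicators are independent given X. -/
theorem integral_edgeInd_sampleGraph {Q : Type} [Fintype Q] (G : SimpleGraph Q) {ι : Q → ℕ}
    (hι : ι.Injective) (W : Graphon) (X : ℕ → I) :
    ∫ U : ℕ × ℕ → I, edgeProd G (fun e => edgeInd (sampleGraph W X U) (e.map ι))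
      ∂(Measure.infinitePi fun _ => volume) =
    edgeProd G fun e => W.edge (e.map fun b => X (ι b)) := by
  classical
  have hd : ∀ e : G.edgeSet, ¬ (e.1.map ι).IsDiag := by
    rintro ⟨e, he⟩ h
    rw [Sym2.isDiag_map hι] at h
    exact G.not_isDiag_of_mem_edgeSet he h
  have hκ : (fun e : G.edgeSet => (Sym2.sortEquiv (e.1.map ι)).1).Injective := by
    intro e e' h
    exact Subtype.ext (Sym2.map.injective hι (Sym2.sortEquiv.injective (Subtype.ext h)))
  unfold edgeProd
  simp_rw [fun e U => edgeInd_sampleGraph W X U (hd e)]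
  rw [integral_prod_infinitePi (volume : Measure I) hκ (f := fun e u =>
    if (u : ℝ) < W.edge ((e.1.map ι).map X) then 1 else 0)]
  · refine Finset.prod_congr rfl fun e _ => ?_
    rw [integral_indicator_lt (W.edge_mem _), Sym2.map_map]
    rfl
  · intro e
    exact Measurable.ite (measurableSet_lt measurable_subtype_coe measurable_const)
      measurable_const measurable_const

theorem measurable_edgeInd_sampleGraph {A : Type} [MeasurableSpace A] (H : RandomGraphon)
    {f : A → H.Ω} {X : A → ℕ → I} {U : A → ℕ × ℕ → I} (hf : Measurable f) (hX : Measurable X)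
    (hU : Measurable U) (e : Sym2 ℕ) :
    Measurable fun r => edgeInd (sampleGraph (H.graphon (f r)) (X r) (U r)) e := by
  classical
  by_cases he : e.IsDiag
  · have h : ∀ r, edgeInd (sampleGraph (H.graphon (f r)) (X r) (U r)) e = 0 := fun r =>
      if_neg fun h => SimpleGraph.not_isDiag_of_mem_edgeSet _ h he
    simp_rw [h]
    exact measurable_const
  · simp_rw [fun r => edgeInd_sampleGraph (H.graphon (f r)) (X r) (U r) he]
    refine Measurable.ite (measurableSet_lt (by fun_prop) ?_) measurable_const measurable_const
    exact H.measurable_edge hf (by fun_prop) e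

theorem integral_edge_infinitePi {Q : Type} [Fintype Q] (G : SimpleGraph Q) {ι : Q → ℕ}
    (hι : ι.Injective) (W : Graphon) :
    ∫ X : ℕ → I, edgeProd G (fun e => W.edge (e.map fun b => X (ι b)))
      ∂(Measure.infinitePi fun _ : ℕ => (volume : Measure I)) = density G W := by
  have hp := map_infinitePi_comp_injective (volume : Measure I) hι
  have hme : Measurable fun x : Q → I => edgeProd G fun e => W.edge (e.map x) :=
    measurable_edgeProd G fun e => W.measurable_edge (fun a => by fun_prop) e
  have hi := integral_map (μ := Measure.infinitePi fun _ : ℕ => (volume : Measure I))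
    hp.measurable.aemeasurable hme.aestronglyMeasurable
  rw [hp.map_eq] at hi
  exact hi.symm

/-- The positions of the vertices `ι b` are i.i.d. uniform for every injection ι, so the probability
of finding G there does not depend on ι. -/
theorem integral_sampleGraph {Q : Type} [Fintype Q] (G : SimpleGraph Q) {ι : Q → ℕ}
    (hι : ι.Injective) (H : RandomGraphon) :
    ∫ r, edgeProd G (fun e => edgeInd (sampleGraph (H.graphon r.1) r.2.1 r.2.2) (e.map ι))
      ∂(H.P.prod ((Measure.infinitePi fun _ : ℕ => (volume : Measure I)).prod
        (Measure.infinitePi fun _ : ℕ × ℕ => (volume : Measure I)))) = meanDensity G H := by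
  have hm : Measurable fun r : H.Ω × (ℕ → I) × (ℕ × ℕ → I) => edgeProd G
      (fun e => edgeInd (sampleGraph (H.graphon r.1) r.2.1 r.2.2) (e.map ι)) :=
    measurable_edgeProd G fun e => measurable_edgeInd_sampleGraph H measurable_fst
      (by fun_prop) (by fun_prop) (e.map ι)
  rw [integral_prod _ (integrable_of_mem_Icc hm fun r => edgeProd_mem G fun e => edgeInd_mem _ _)]
  refine integral_congr_ae (ae_of_all _ fun h => ?_)
  have hm' : Measurable fun y : (ℕ → I) × (ℕ × ℕ → I) =>
      edgeProd G fun e => edgeInd (sampleGraph (H.graphon h) y.1 y.2) (e.map ι) :=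
    measurable_edgeProd G fun e => measurable_edgeInd_sampleGraph H measurable_const
      measurable_fst measurable_snd (e.map ι)
  refine (integral_prod _ (integrable_of_mem_Icc hm' fun r =>
    edgeProd_mem G fun e => edgeInd_mem _ _)).trans ?_
  refine Eq.trans ?_ (integral_edge_infinitePi G hι (H.graphon h))
  exact integral_congr_ae (ae_of_all _ fun X => integral_edgeInd_sampleGraph G hι _ X)

/-! ### Expected densities as sums over colorings and their partitions -/

/-- The contribution of a partition of the vertices, given as the fibers of a map, to the expected
density of a block graphon. -/
def partitionTerm {V Q : Type} [Fintype V] [Fintype Q] (H C : RandomGraphon) (F : SimpleGraph V)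
    (p : V → Q) : ℝ := (∏ b, meanDensity (fiberGraph p b F) C) * meanDensity (F.map p) H

theorem meanDensity_mem {V : Type} [Fintype V] (G : SimpleGraph V) (W : RandomGraphon) :
    meanDensity G W ∈ Icc (0 : ℝ) 1 :=
  integral_mem_Icc _ fun _ => density_mem G _

theorem partitionTerm_mem {V Q : Type} [Fintype V] [Fintype Q] (H C : RandomGraphon)
    (F : SimpleGraph V) (p : V → Q) : partitionTerm H C F p ∈ Icc (0 : ℝ) 1 := by
  have h1 := fun b => meanDensity_mem (fiberGraph p b F) C
  have h2 := meanDensity_mem (F.map p) H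
  exact ⟨mul_nonneg (Finset.prod_nonneg fun b _ => (h1 b).1) h2.1,
    mul_le_one₀ (Finset.prod_le_one (fun b _ => (h1 b).1) fun b _ => (h1 b).2) h2.1 h2.2⟩

/-- The law of everything but the block lengths in the definition of the Poisson-Dirichlet
graphon. -/
def decorationLaw (H C : RandomGraphon) :
    Measure ((ℕ → C.Ω) × H.Ω × (ℕ → I) × (ℕ × ℕ → I)) :=
  (Measure.infinitePi fun _ : ℕ => C.P).prod (H.P.prod
    ((Measure.infinitePi fun _ : ℕ => (volume : Measure I)).prod
      (Measure.infinitePi fun _ : ℕ × ℕ => (volume : Measure I))))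

instance (H C : RandomGraphon) : IsProbabilityMeasure (decorationLaw H C) := by
  unfold decorationLaw; infer_instance

/-- The set of blocks of a partition. -/
def Blocks {V : Type} (s : Setoid V) : Type := Quotient s

/-- The block of an element. -/
def toBlock {V : Type} (s : Setoid V) (a : V) : Blocks s := Quotient.mk s a

theorem toBlock_surjective {V : Type} (s : Setoid V) : (toBlock s).Surjective :=
  Quotient.mk_surjective

theorem toBlock_eq_iff {V : Type} {s : Setoid V} {a b : V} :
    toBlock s a = toBlock s b ↔ s a b := Quotient.eq

instance {V : Type} [Finite V] (s : Setoid V) : Finite (Blocks s) :=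
  Finite.of_surjective _ (toBlock_surjective s)

instance {V : Type} [Finite V] (s : Setoid V) : Fintype (Blocks s) := Fintype.ofFinite _

/-- The color of a block, for the partition of the vertices according to their colors. -/
def blockColor {V : Type} (c : V → ℕ) : Blocks (Setoid.ker c) → ℕ :=
  Quotient.lift c fun _ _ h => h

theorem blockColor_injective {V : Type} (c : V → ℕ) : (blockColor c).Injective :=
  Setoid.kerLift_injective c

/-- The value depends on the coloring only through its kernel: different colors carry i.i.d. copies
of C, and the sampled graph is exchangeable. Measurability is stated alongside because both follow
from the same factorization. -/
theorem integral_colorEdge_decoration {V : Type} [Fintype V] (F : SimpleGraph V) (c : V → ℕ)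
    (H C : RandomGraphon) :
    Measurable (fun r : (ℕ → C.Ω) × H.Ω × (ℕ → I) × (ℕ × ℕ → I) =>
      ∫ u : V → I, edgeProd F (colorEdge (fun i => C.graphon (r.1 i))
        (sampleGraph (H.graphon r.2.1) r.2.2.1 r.2.2.2) c u)) ∧
    ∫ r, (∫ u : V → I, edgeProd F (colorEdge (fun i => C.graphon (r.1 i))
        (sampleGraph (H.graphon r.2.1) r.2.2.1 r.2.2.2) c u)) ∂(decorationLaw H C) =
      partitionTerm H C F (toBlock (Setoid.ker c)) := by
  have hι := blockColor_injective c
  have h : ∀ r : (ℕ → C.Ω) × H.Ω × (ℕ → I) × (ℕ × ℕ → I),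
      ∫ u : V → I, edgeProd F (colorEdge (fun i => C.graphon (r.1 i))
        (sampleGraph (H.graphon r.2.1) r.2.2.1 r.2.2.2) c u) = _ := fun r =>
    integral_colorEdge F (toBlock (Setoid.ker c)) hι _ _
  simp_rw [h]
  constructor
  · refine Measurable.mul (Finset.measurable_prod _ fun b _ => ?_) ?_
    · exact C.measurable_density _ (by fun_prop)
    · exact measurable_edgeProd _ fun e => measurable_edgeInd_sampleGraph H (by fun_prop)
        (by fun_prop) (by fun_prop) _
  · rw [decorationLaw, integral_prod_mul (fun ω : ℕ → C.Ω =>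
      ∏ b, density (fiberGraph (toBlock (Setoid.ker c)) b F) (C.graphon (ω (blockColor c b))))
      (fun r : H.Ω × (ℕ → I) × (ℕ × ℕ → I) => edgeProd (F.map (toBlock (Setoid.ker c)))
        fun e => edgeInd (sampleGraph (H.graphon r.1) r.2.1 r.2.2) (e.map (blockColor c))),
      integral_sampleGraph _ hι,
      integral_prod_infinitePi C.P hι (f := fun b ω =>
        density (fiberGraph (toBlock (Setoid.ker c)) b F) (C.graphon ω))
        (fun b => C.measurable_density _ measurable_id)]
    rfl

theorem integral_density_blockGraphon {V : ℕ → ℝ} (h0 : ∀ i, 0 < V i) (h1 : HasSum V 1) {A : Type}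
    [Fintype A] (F : SimpleGraph A) (H C : RandomGraphon) :
    ∫ r, density F (blockGraphon V (fun i => C.graphon (r.1 i))
        (sampleGraph (H.graphon r.2.1) r.2.2.1 r.2.2.2)) ∂(decorationLaw H C) =
      ∑' c : A → ℕ, (∏ a, V (c a)) * partitionTerm H C F (toBlock (Setoid.ker c)) := by
  have := isProbabilityMeasure_colorLaw (fun i => (h0 i).le) h1
  simp_rw [density_blockGraphon h0 h1]
  rw [integral_integral_swap]
  · simp_rw [fun c : A → ℕ => (integral_colorEdge_decoration F c H C).2]
    exact integral_pi_colorLaw (fun i => (h0 i).le) h1 fun c => partitionTerm_mem H C F _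
  · refine integrable_of_mem_Icc ?_ fun r => integral_mem_Icc _ fun u =>
      edgeProd_mem F fun e => colorEdge_mem _ _ _ _ e
    exact measurable_from_prod_countable_left fun c => (integral_colorEdge_decoration F c H C).1

/-! ### Ranking a summable positive sequence -/

/-- The strict order on indices by decreasing value, with ties broken by the index. -/
def Precedes (v : ℕ → ℝ) (i j : ℕ) : Prop := v j < v i ∨ (v i = v j ∧ i < j)

theorem Precedes.trans {v : ℕ → ℝ} {i j k : ℕ} (h : Precedes v i j) (h' : Precedes v j k) :
    Precedes v i k := by
  rcases h with h | ⟨h, h1⟩ <;> rcases h' with h' | ⟨h', h2⟩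
  · exact Or.inl (h'.trans h)
  · exact Or.inl (h' ▸ h)
  · exact Or.inl (h ▸ h')
  · exact Or.inr ⟨h.trans h', h1.trans h2⟩

theorem Precedes.irrefl {v : ℕ → ℝ} (i : ℕ) : ¬ Precedes v i i := by simp [Precedes]

theorem precedes_or_precedes (v : ℕ → ℝ) {i j : ℕ} (h : i ≠ j) :
    Precedes v i j ∨ Precedes v j i := by
  rcases lt_trichotomy (v i) (v j) with h1 | h1 | h1
  · exact Or.inr (Or.inl h1)
  · rcases lt_or_gt_of_ne h with h2 | h2
    · exact Or.inl (Or.inr ⟨h1, h2⟩)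
    · exact Or.inr (Or.inr ⟨h1.symm, h2⟩)
  · exact Or.inl (Or.inl h1)

theorem Precedes.le {v : ℕ → ℝ} {i j : ℕ} (h : Precedes v i j) : v j ≤ v i := by
  rcases h with h | h
  · exact h.le
  · exact h.1.ge

theorem exists_perm_precedes {v : ℕ → ℝ} (h0 : ∀ i, 0 < v i) (hs : Summable v) :
    ∃ τ : ℕ ≃ ℕ, ∀ m n, m < n → Precedes v (τ m) (τ n) := by
  classical
  -- A summable sequence tends to zero, so only finitely many terms are at least v i; the rank of i
  -- is the number of its predecessors.
  have hfin : ∀ i, {j | Precedes v j i}.Finite := fun i => by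
    have h := hs.tendsto_cofinite_zero.eventually (gt_mem_nhds (h0 i))
    rw [Filter.eventually_cofinite] at h
    exact h.subset fun j hj => not_lt.2 hj.le
  let rank : ℕ → ℕ := fun i => (hfin i).toFinset.card
  have hmono : ∀ {i j}, Precedes v i j → rank i < rank j := fun {i j} h => by
    refine Finset.card_lt_card (Finset.ssubset_iff_of_subset ?_ |>.2 ⟨i, ?_, ?_⟩)
    · intro k hk
      rw [Set.Finite.mem_toFinset] at hk ⊢
      exact Precedes.trans hk h
    · rw [Set.Finite.mem_toFinset]; exact h
    · rw [Set.Finite.mem_toFinset]; exact Precedes.irrefl i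
  have hinj : rank.Injective := fun i j h => by
    by_contra hij
    rcases precedes_or_precedes v hij with h1 | h1
    · exact (hmono h1).ne h
    · exact (hmono h1).ne' h
  -- Ranks are unbounded by injectivity. If m < rank i, the rank i many predecessors of i have
  -- distinct ranks below rank i and therefore fill all these values, m included.
  have hsurj : rank.Surjective := fun m => by
    obtain ⟨i, hi⟩ : ∃ i, m < rank i := by
      by_contra h
      push Not at h
      exact Set.infinite_range_of_injective hinj ((Set.finite_Iic m).subset
        (Set.range_subset_iff.2 h))
    have h := Finset.surjOn_of_injOn_of_card_le rank (s := (hfin i).toFinset)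
      (t := Finset.range (rank i)) (fun j hj => by
        have hj' : Precedes v j i := by simpa using hj
        simpa using hmono hj') hinj.injOn (by simp [rank])
    obtain ⟨j, -, hj⟩ := h (by simpa using hi)
    exact ⟨j, hj⟩
  refine ⟨(Equiv.ofBijective rank ⟨hinj, hsurj⟩).symm, fun m n hmn => ?_⟩
  have hr : ∀ k, rank ((Equiv.ofBijective rank ⟨hinj, hsurj⟩).symm k) = k :=
    (Equiv.ofBijective rank ⟨hinj, hsurj⟩).apply_symm_apply
  set τ := (Equiv.ofBijective rank ⟨hinj, hsurj⟩).symm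
  rcases precedes_or_precedes v (i := τ m) (j := τ n) (τ.injective.ne hmn.ne) with h | h
  · exact h
  · have := hmono h
    rw [hr, hr] at this
    omega

theorem exists_perm_ranked {v : ℕ → ℝ} (h0 : ∀ i, 0 < v i) (hs : Summable v) :
    ∃ τ : ℕ ≃ ℕ, ranked v = v ∘ τ := by
  classical
  obtain ⟨τ, hτ⟩ := exists_perm_precedes h0 hs
  refine ⟨τ, funext fun l => ?_⟩
  have hanti : ∀ {m n}, m ≤ n → v (τ n) ≤ v (τ m) := fun {m n} h => by
    rcases h.eq_or_lt with rfl | h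
    · rfl
    · exact (hτ _ _ h).le
  have hle : ∀ S : {S : Finset ℕ // S.card = l + 1}, ⨅ i : S.1, v i ≤ v (τ l) := by
    rintro ⟨S, hS⟩
    -- Pigeonhole: of l + 1 indices, at most l have rank below l.
    obtain ⟨s, hs, hl⟩ : ∃ s ∈ S, l ≤ τ.symm s := by
      by_contra h
      push Not at h
      have := Finset.card_le_card_of_injOn (t := Finset.range l) τ.symm
        (fun s hs => by simpa using h s hs) τ.symm.injective.injOn
      simp at this
      omega
    refine (ciInf_le (Set.finite_range _).bddBelow (⟨s, hs⟩ : S)).trans ?_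
    simpa using hanti hl
  have hcard : ((Finset.range (l + 1)).map τ.toEmbedding).card = l + 1 := by simp
  have : Nonempty {S : Finset ℕ // S.card = l + 1} := ⟨⟨_, hcard⟩⟩
  refine le_antisymm (ciSup_le hle) ?_
  · refine le_ciSup_of_le ⟨v (τ l), ?_⟩ ⟨_, hcard⟩ ?_
    · rintro _ ⟨S, rfl⟩
      exact hle S
    · have : Nonempty {x // x ∈ (Finset.range (l + 1)).map τ.toEmbedding} :=
        ⟨⟨τ 0, by simp⟩⟩
      refine le_ciInf ?_
      rintro ⟨i, hi⟩
      obtain ⟨m, hm, rfl⟩ := Finset.mem_map.1 hi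
      exact hanti (by simpa using Nat.lt_succ_iff.1 (Finset.mem_range.1 hm))

/-! ### The exchangeable partition probability function of stick breaking -/

open scoped ENNReal
/-- The sum of `∏ q, v (ι q) ^ n q` over all families of distinct indices `ι q`. -/
def distinctSum {Q : Type} [Fintype Q] (v : ℕ → ℝ) (n : Q → ℕ) : ℝ≥0∞ :=
  ∑' ι : Q ↪ ℕ, ∏ q, ENNReal.ofReal (v (ι q)) ^ n q

theorem distinctSum_equiv {Q Q' : Type} [Fintype Q] [Fintype Q'] (e : Q ≃ Q') (v : ℕ → ℝ)
    (n : Q' → ℕ) : distinctSum v (n ∘ e) = distinctSum v n := by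
  unfold distinctSum
  rw [← (Equiv.embeddingCongr e (Equiv.refl ℕ)).tsum_eq]
  refine tsum_congr fun ι => ?_
  rw [← e.prod_comp]
  simp

theorem distinctSum_fin_zero (v : ℕ → ℝ) (n : Fin 0 → ℕ) : distinctSum v n = 1 := by
  unfold distinctSum
  rw [tsum_eq_single (default : Fin 0 ↪ ℕ) fun b hb => absurd (Subsingleton.elim _ _) hb]
  simp

/-- Extends an embedding to an additional argument, which is mapped to zero. -/
def insertZero {k : ℕ} (j : Fin (k + 1)) (ι : Fin k ↪ ℕ) : Fin (k + 1) ↪ ℕ where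
  toFun := Fin.insertNth (α := fun _ => ℕ) j 0 fun q => ι q + 1
  inj' a b h := by
    rcases Fin.eq_self_or_eq_succAbove j a with ha | ⟨a, rfl⟩ <;>
    rcases Fin.eq_self_or_eq_succAbove j b with hb | ⟨b, rfl⟩
    · rw [ha, hb]
    · simp [ha] at h
    · simp [hb] at h
    · simp only [Fin.insertNth_apply_succAbove, Nat.add_right_cancel_iff] at h
      rw [ι.injective h]

@[simp] theorem insertZero_same {k : ℕ} (j : Fin (k + 1)) (ι : Fin k ↪ ℕ) :
    insertZero j ι j = 0 := by
  change Fin.insertNth (α := fun _ => ℕ) j 0 (fun q => ι q + 1) j = 0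
  simp

@[simp] theorem insertZero_succAbove {k : ℕ} (j : Fin (k + 1)) (ι : Fin k ↪ ℕ) (q : Fin k) :
    insertZero j ι (j.succAbove q) = ι q + 1 := by
  change Fin.insertNth (α := fun _ => ℕ) j 0 (fun q => ι q + 1) (j.succAbove q) = ι q + 1
  simp

/-- The embeddings of `Fin (k + 1)` into `ℕ`, according to the preimage of zero. -/
def embeddingOfTail (k : ℕ) : (Fin (k + 1) ↪ ℕ) ⊕ (Fin (k + 1) × (Fin k ↪ ℕ)) → (Fin (k + 1) ↪ ℕ)
  | Sum.inl ι => ι.trans ⟨Nat.succ, Nat.succ_injective⟩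
  | Sum.inr (j, ι) => insertZero j ι

theorem embeddingOfTail_bijective (k : ℕ) : (embeddingOfTail k).Bijective := by
  constructor
  · rintro (ι | ⟨j, ι⟩) (ι' | ⟨j', ι'⟩) h
    · congr 1
      ext q
      exact Nat.succ_injective (DFunLike.congr_fun h q)
    · have h1 : ι j' + 1 = insertZero j' ι' j' := DFunLike.congr_fun h j'
      simp at h1
    · have h1 : insertZero j ι j = ι' j + 1 := DFunLike.congr_fun h j
      simp at h1
    · have h' : insertZero j ι = insertZero j' ι' := h
      have h1 := DFunLike.congr_fun h' j
      rcases Fin.eq_self_or_eq_succAbove j' j with rfl | ⟨a, rfl⟩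
      · congr 2
        ext q
        have := DFunLike.congr_fun h' (j.succAbove q)
        simpa using this
      · simp at h1
  · intro ι
    by_cases h : ∃ j, ι j = 0
    · obtain ⟨j, hj⟩ := h
      have hne : ∀ q, ι (j.succAbove q) ≠ 0 := fun q hq =>
        Fin.succAbove_ne j q (ι.injective (hq.trans hj.symm))
      refine ⟨Sum.inr (j, ⟨fun q => ι (j.succAbove q) - 1, fun a b hab => ?_⟩), ?_⟩
      · have h1 := hne a
        have h2 := hne b
        have h3 : ι (j.succAbove a) = ι (j.succAbove b) := by simp only at hab; omega
        exact Fin.succAbove_right_injective (ι.injective h3)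
      · refine DFunLike.ext _ _ fun q => ?_
        change insertZero j _ q = _
        rcases Fin.eq_self_or_eq_succAbove j q with rfl | ⟨a, rfl⟩
        · rw [insertZero_same, hj]
        · rw [insertZero_succAbove]
          exact Nat.sub_add_cancel (Nat.pos_of_ne_zero (hne a))
    · push Not at h
      refine ⟨Sum.inl ⟨fun q => ι q - 1, fun a b hab => ?_⟩, ?_⟩
      · have h1 := h a
        have h2 := h b
        exact ι.injective (by simp only at hab; omega)
      · ext q
        exact Nat.sub_add_cancel (Nat.pos_of_ne_zero (h q))

/-- At most one of the distinct indices is 0. If none is, all of them lie in the tail; if the one of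
block j is, that block contributes y to the power n j and the remaining blocks lie in the tail. The
tail is scaled by 1 − y. -/
theorem distinctSum_succ {k : ℕ} {v v' : ℕ → ℝ} {y : ℝ} (hy : y ≤ 1)
    (h0 : v 0 = y) (h1 : ∀ i, v (i + 1) = (1 - y) * v' i) (n : Fin (k + 1) → ℕ) :
    distinctSum v n = ENNReal.ofReal (1 - y) ^ (∑ q, n q) * distinctSum v' n +
      ∑ j, ENNReal.ofReal y ^ n j * ENNReal.ofReal (1 - y) ^ (∑ q, n (j.succAbove q)) *
        distinctSum v' (fun q => n (j.succAbove q)) := by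
  have hmul : ∀ i, ENNReal.ofReal (v (i + 1)) =
      ENNReal.ofReal (1 - y) * ENNReal.ofReal (v' i) := fun i => by
    rw [h1, ENNReal.ofReal_mul (by linarith)]
  unfold distinctSum
  rw [← (Equiv.ofBijective _ (embeddingOfTail_bijective k)).tsum_eq,
    ENNReal.summable.tsum_sum ENNReal.summable]
  congr 1
  · rw [← ENNReal.tsum_mul_left]
    refine tsum_congr fun ι => ?_
    rw [← Finset.prod_pow_eq_pow_sum, ← Finset.prod_mul_distrib]
    refine Finset.prod_congr rfl fun q _ => ?_
    rw [← mul_pow, ← hmul]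
    rfl
  · rw [ENNReal.tsum_prod' (α := Fin (k + 1)), tsum_fintype]
    refine Finset.sum_congr rfl fun j _ => ?_
    rw [← ENNReal.tsum_mul_left]
    refine tsum_congr fun ι => ?_
    change ∏ q, ENNReal.ofReal (v (insertZero j ι q)) ^ n q = _
    rw [Fin.prod_univ_succAbove _ j, insertZero_same, h0, mul_assoc]
    congr 1
    rw [← Finset.prod_pow_eq_pow_sum, ← Finset.prod_mul_distrib]
    refine Finset.prod_congr rfl fun q _ => ?_
    rw [← mul_pow, ← hmul, insertZero_succAbove]

theorem tsum_fin_pi_prod (k : ℕ) (g : Fin k → ℕ → ℝ≥0∞) :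
    ∑' c : Fin k → ℕ, ∏ q, g q (c q) = ∏ q, ∑' i, g q i := by
  induction k with
  | zero => rw [tsum_eq_single default fun b hb => absurd (Subsingleton.elim _ _) hb]; simp
  | succ k ih =>
    rw [← (Fin.consEquiv fun _ => ℕ).tsum_eq, ENNReal.tsum_prod' (α := ℕ), Fin.prod_univ_succ, ← ih,
      ← ENNReal.tsum_mul_right]
    refine tsum_congr fun i => ?_
    rw [← ENNReal.tsum_mul_left]
    refine tsum_congr fun c => ?_
    simp [Fin.prod_univ_succ]

/-- Exponents can be lowered to 1 and distinctness dropped, which leaves a power of the total mass.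
-/
theorem distinctSum_fin_le_one {k : ℕ} {v : ℕ → ℝ} (h : ∑' i, ENNReal.ofReal (v i) ≤ 1)
    {n : Fin k → ℕ} (hn : ∀ q, 1 ≤ n q) : distinctSum v n ≤ 1 := by
  have hv : ∀ i, ENNReal.ofReal (v i) ≤ 1 := fun i => (ENNReal.le_tsum i).trans h
  unfold distinctSum
  calc ∑' ι : Fin k ↪ ℕ, ∏ q, ENNReal.ofReal (v (ι q)) ^ n q
      ≤ ∑' ι : Fin k ↪ ℕ, ∏ q, ENNReal.ofReal (v (ι q)) :=
        ENNReal.tsum_le_tsum fun ι => Finset.prod_le_prod' fun q _ =>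
          pow_le_of_le_one zero_le (hv _) (Nat.one_le_iff_ne_zero.1 (hn q))
    _ ≤ ∑' c : Fin k → ℕ, ∏ q, ENNReal.ofReal (v (c q)) :=
        ENNReal.tsum_comp_le_tsum_of_injective DFunLike.coe_injective
          fun c : Fin k → ℕ => ∏ q, ENNReal.ofReal (v (c q))
    _ = ∏ q : Fin k, ∑' i, ENNReal.ofReal (v i) := tsum_fin_pi_prod k fun _ i => ENNReal.ofReal (v i)
    _ ≤ 1 := Finset.prod_le_one' fun _ _ => h

/-! ### Stick breaking -/

/-- Adds a first element to a sequence. -/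
def consSeq (p : ℝ × (ℕ → ℝ)) : ℕ → ℝ
  | 0 => p.1
  | l + 1 => p.2 l

theorem measurable_consSeq : Measurable consSeq := by
  refine measurable_pi_lambda _ fun l => ?_
  cases l with
  | zero => exact measurable_fst
  | succ l => exact (measurable_pi_apply l).comp measurable_snd

theorem stickBreaking_consSeq_zero (y : ℝ) (Y : ℕ → ℝ) : stickBreaking (consSeq (y, Y)) 0 = y := by
  simp [stickBreaking, consSeq]

theorem stickBreaking_consSeq_succ (y : ℝ) (Y : ℕ → ℝ) (l : ℕ) :
    stickBreaking (consSeq (y, Y)) (l + 1) = (1 - y) * stickBreaking Y l := by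
  simp only [stickBreaking, Finset.prod_range_succ', consSeq]
  ring

/-- After the first stick, the ℓ-th remaining variable is Beta(1 − α, (θ + α) + ℓα), so the tail is
again stick breaking, with θ replaced by θ + α. -/
theorem map_consSeq (α θ : ℝ) :
    ((betaLaw (1 - α) (θ + α)).prod (stickLaw α (θ + α))).map consSeq = stickLaw α θ := by
  classical
  refine Measure.eq_infinitePi _ fun s t ht => ?_
  have hle : (s : Set ℕ) ⊆ Finset.range (s.sup id + 1 + 1) := fun i hi => by
    simpa using Nat.lt_succ_of_lt (Nat.lt_succ_of_le (Finset.le_sup (f := id) hi))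
  set m := s.sup id + 1
  -- Padding with `univ` turns the cylinder over `s` into one over an initial segment, where
  -- splitting off coordinate 0 is a shift.
  let t' : ℕ → Set ℝ := fun i => if i ∈ s then t i else univ
  have ht' : ∀ i, MeasurableSet (t' i) := fun i => by
    by_cases hi : i ∈ s <;> simp [t', hi, ht i]
  have hpre : consSeq ⁻¹' (Set.pi s t) =
      t' 0 ×ˢ Set.pi (Finset.range m) fun i => t' (i + 1) := by
    ext ⟨y, Y⟩
    simp only [mem_preimage, Set.mem_pi, mem_prod, Finset.mem_coe, Finset.mem_range]
    constructor
    · intro h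
      refine ⟨?_, fun i _ => ?_⟩
      · by_cases h0 : 0 ∈ s
        · simpa [t', h0] using! h 0 h0
        · simp [t', h0]
      · by_cases h0 : i + 1 ∈ s
        · simpa [t', h0] using! h (i + 1) h0
        · simp [t', h0]
    · rintro ⟨h1, h2⟩ i hi
      cases i with
      | zero => simpa [t', hi] using! h1
      | succ i =>
        have := h2 i (by simpa using hle hi)
        simpa [t', hi] using! this
  rw [Measure.map_apply measurable_consSeq (MeasurableSet.pi s.countable_toSet fun i _ => ht i),
    hpre, Measure.prod_prod, stickLaw, Measure.infinitePi_pi _ fun i _ => ht' _]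
  have hprod : ∏ i ∈ s, betaLaw (1 - α) (θ + (i + 1) * α) (t i) =
      ∏ i ∈ Finset.range (m + 1), betaLaw (1 - α) (θ + (i + 1) * α) (t' i) := by
    rw [← Finset.prod_subset (s₁ := s) (s₂ := Finset.range (m + 1)) (by exact_mod_cast hle)]
    · exact Finset.prod_congr rfl fun i hi => by simp [t', hi]
    · intro i _ hi
      simp [t', hi]
  rw [hprod, Finset.prod_range_succ' _ m, mul_comm]
  congr 1
  · refine Finset.prod_congr rfl fun i _ => ?_
    congr 2
    push_cast
    ring
  · congr 2
    simp

/-! ### Rising factorials, beta moments and the stick-breaking recursion -/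

/-- The rising factorial. -/
def rising (x : ℝ) (m : ℕ) : ℝ := ∏ i ∈ Finset.range m, (x + i)

@[simp] theorem rising_zero (x : ℝ) : rising x 0 = 1 := by simp [rising]

theorem rising_succ (x : ℝ) (m : ℕ) : rising x (m + 1) = rising x m * (x + m) :=
  Finset.prod_range_succ _ _

theorem rising_succ' (x : ℝ) (m : ℕ) : rising x (m + 1) = x * rising (x + 1) m := by
  unfold rising
  rw [Finset.prod_range_succ', mul_comm]
  congr 1
  · simp
  · refine Finset.prod_congr rfl fun i _ => ?_
    push_cast
    ring

theorem rising_pos {x : ℝ} (hx : 0 < x) (m : ℕ) : 0 < rising x m :=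
  Finset.prod_pos fun i _ => by positivity

theorem Gamma_add_nat {x : ℝ} (hx : 0 < x) (m : ℕ) :
    Real.Gamma (x + m) = rising x m * Real.Gamma x := by
  induction m with
  | zero => simp
  | succ m ih =>
    have : x + (m : ℝ) ≠ 0 := by positivity
    rw [Nat.cast_succ, ← add_assoc, Real.Gamma_add_one this, ih, rising_succ]
    ring

theorem beta_add_nat {A B : ℝ} (hA : 0 < A) (hB : 0 < B) (a b : ℕ) :
    beta (A + a) (B + b) / beta A B = rising A a * rising B b / rising (A + B) (a + b) := by
  have h1 : A + a + (B + b) = A + B + ((a + b : ℕ) : ℝ) := by push_cast; ring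
  have h2 := (rising_pos (add_pos hA hB) (a + b)).ne'
  have h3 := (Real.Gamma_pos_of_pos hA).ne'
  have h4 := (Real.Gamma_pos_of_pos hB).ne'
  have h5 := (Real.Gamma_pos_of_pos (add_pos hA hB)).ne'
  unfold beta
  rw [h1, Gamma_add_nat hA, Gamma_add_nat hB, Gamma_add_nat (add_pos hA hB)]
  field_simp

/-- Multiplying the Beta(A, B) density by the integrand gives the Beta(A + a, B + b) density up to
the ratio of the normalizing constants. -/
theorem lintegral_betaLaw {A B : ℝ} (hA : 0 < A) (hB : 0 < B) (a b : ℕ) :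
    ∫⁻ y, ENNReal.ofReal y ^ a * ENNReal.ofReal (1 - y) ^ b ∂(betaLaw A B) =
      ENNReal.ofReal (rising A a * rising B b / rising (A + B) (a + b)) := by
  have hAa : 0 < A + a := by positivity
  have hBb : 0 < B + b := by positivity
  have hm : Measurable (betaPDF A B) := (measurable_betaPDFReal A B).ennreal_ofReal
  rw [betaLaw, if_pos ⟨hA, hB⟩, betaMeasure, lintegral_withDensity_eq_lintegral_mul _ hm
    (by fun_prop), ← beta_add_nat hA hB]
  have hpt : ∀ y, (betaPDF A B * fun y => ENNReal.ofReal y ^ a * ENNReal.ofReal (1 - y) ^ b) y =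
      ENNReal.ofReal (beta (A + a) (B + b) / beta A B) * betaPDF (A + a) (B + b) y := by
    intro y
    simp only [Pi.mul_apply]
    by_cases hy : 0 < y ∧ y < 1
    · have hy1 : 0 < 1 - y := by linarith [hy.2]
      have hb1 := beta_pos hA hB
      have hb2 := beta_pos hAa hBb
      rw [betaPDF_of_pos_lt_one hy.1 hy.2, betaPDF_of_pos_lt_one hy.1 hy.2,
        ← ENNReal.ofReal_pow hy.1.le, ← ENNReal.ofReal_pow hy1.le,
        ← ENNReal.ofReal_mul (by have := hy.1; positivity), ← ENNReal.ofReal_mul (by have := hy.1; positivity),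
        ← ENNReal.ofReal_mul (by positivity)]
      congr 1
      rw [show A + a - 1 = (A - 1) + a by ring, show B + b - 1 = (B - 1) + b by ring,
        Real.rpow_add_natCast hy.1.ne', Real.rpow_add_natCast hy1.ne']
      field_simp
    · rw [betaPDF_eq, betaPDF_eq, if_neg hy, if_neg hy]
      simp
  simp_rw [hpt]
  rw [lintegral_const_mul _ (show Measurable (betaPDF _ _) from
    (measurable_betaPDFReal _ _).ennreal_ofReal),
    lintegral_betaPDF_eq_one hAa hBb, mul_one]

theorem ae_betaLaw {A B : ℝ} (hA : 0 < A) (hB : 0 < B) :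
    ∀ᵐ y ∂(betaLaw A B), y ∈ Ioo (0 : ℝ) 1 := by
  have hm : Measurable (betaPDF A B) := (measurable_betaPDFReal A B).ennreal_ofReal
  rw [betaLaw, if_pos ⟨hA, hB⟩, betaMeasure, ae_withDensity_iff hm]
  refine ae_of_all _ fun y hy => ?_
  constructor
  · by_contra h
    exact hy (betaPDF_eq_zero_of_nonpos (not_lt.1 h))
  · by_contra h
    exact hy (betaPDF_eq_zero_of_one_le (not_lt.1 h))

theorem stick_param_pos {α θ : ℝ} (h0 : 0 < α) (hθ : -α < θ) (l : ℕ) :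
    0 < θ + (l + 1) * α := by
  have : 0 ≤ l * α := by positivity
  linarith

theorem ae_stickLaw {α θ : ℝ} (h0 : 0 < α) (h1 : α < 1) (hθ : -α < θ) :
    ∀ᵐ Y ∂(stickLaw α θ), ∀ l, Y l ∈ Ioo (0 : ℝ) 1 := by
  rw [ae_all_iff]
  intro l
  have hmp := measurePreserving_eval_infinitePi
    (fun l : ℕ => betaLaw (1 - α) (θ + (l + 1) * α)) l
  exact hmp.quasiMeasurePreserving.ae (ae_betaLaw (by linarith) (stick_param_pos h0 hθ l))

theorem stickBreaking_pos {Y : ℕ → ℝ} (hY : ∀ l, Y l ∈ Ioo (0 : ℝ) 1) (l : ℕ) :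
    0 < stickBreaking Y l :=
  mul_pos (hY l).1 (Finset.prod_pos fun i _ => by linarith [(hY i).2])

theorem sum_stickBreaking (Y : ℕ → ℝ) (m : ℕ) :
    ∑ l ∈ Finset.range m, stickBreaking Y l = 1 - ∏ i ∈ Finset.range m, (1 - Y i) := by
  induction m with
  | zero => simp
  | succ m ih =>
    rw [Finset.sum_range_succ, ih, Finset.prod_range_succ, stickBreaking]
    ring

theorem tsum_stickBreaking_le_one {Y : ℕ → ℝ} (hY : ∀ l, Y l ∈ Ioo (0 : ℝ) 1) :
    ∑' l, ENNReal.ofReal (stickBreaking Y l) ≤ 1 := by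
  refine ENNReal.tsum_le_of_sum_range_le fun m => ?_
  rw [← ENNReal.ofReal_sum_of_nonneg fun l _ => (stickBreaking_pos hY l).le, sum_stickBreaking]
  refine ENNReal.ofReal_le_one.2 ?_
  have : 0 ≤ ∏ i ∈ Finset.range m, (1 - Y i) :=
    Finset.prod_nonneg fun i _ => by linarith [(hY i).2]
  linarith

theorem measurable_stickBreaking (l : ℕ) : Measurable fun Y => stickBreaking Y l :=
  (measurable_pi_apply _).mul (Finset.measurable_prod _ fun _ _ =>
    measurable_const.sub (measurable_pi_apply _))

theorem measurable_distinctSum {Q : Type} [Fintype Q] (n : Q → ℕ) :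
    Measurable fun Y => distinctSum (stickBreaking Y) n := by
  have : Countable (Q ↪ ℕ) := DFunLike.coe_injective.countable
  refine Measurable.tsum fun ι => Finset.measurable_prod _ fun q _ => ?_
  exact (measurable_stickBreaking _).ennreal_ofReal.pow_const _

/-- The expectation of `distinctSum` for stick breaking. -/
def stickMoment (α θ : ℝ) {Q : Type} [Fintype Q] (n : Q → ℕ) : ℝ≥0∞ :=
  ∫⁻ Y, distinctSum (stickBreaking Y) n ∂(stickLaw α θ)

theorem stickMoment_fin_le_one {α θ : ℝ} (h0 : 0 < α) (h1 : α < 1) (hθ : -α < θ) {k : ℕ}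
    {n : Fin k → ℕ} (hn : ∀ q, 1 ≤ n q) : stickMoment α θ n ≤ 1 := by
  unfold stickMoment
  refine (lintegral_mono_ae (g := fun _ => 1) ?_).trans (by simp)
  filter_upwards [ae_stickLaw h0 h1 hθ] with Y hY
  exact distinctSum_fin_le_one (tsum_stickBreaking_le_one hY) hn

theorem stickMoment_fin_zero (α θ : ℝ) (n : Fin 0 → ℕ) : stickMoment α θ n = 1 := by
  simp [stickMoment, distinctSum_fin_zero]

/-- The moment `E[Y^a (1-Y)^b]` of the first stick breaking variable. -/
def betaMoment (α θ : ℝ) (a b : ℕ) : ℝ :=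
  rising (1 - α) a * rising (θ + α) b / rising (θ + 1) (a + b)

/-- The expectation of `distinctSum_succ`, using that the first stick is independent of the tail.
The first term has the same sizes n at parameter θ + α, so this alone is not a recursion on the
number of blocks. -/
theorem stickMoment_succ {α θ : ℝ} (h1 : α < 1) (hθ : -α < θ) {k : ℕ}
    (n : Fin (k + 1) → ℕ) :
    stickMoment α θ n =
      ENNReal.ofReal (betaMoment α θ 0 (∑ q, n q)) * stickMoment α (θ + α) n +
      ∑ j, ENNReal.ofReal (betaMoment α θ (n j) (∑ q, n (j.succAbove q))) *
        stickMoment α (θ + α) (fun q => n (j.succAbove q)) := by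
  have hA : 0 < 1 - α := by linarith
  have hB : 0 < θ + α := by linarith
  have hbeta : ∀ a b, ∫⁻ y, ENNReal.ofReal y ^ a * ENNReal.ofReal (1 - y) ^ b
      ∂(betaLaw (1 - α) (θ + α)) = ENNReal.ofReal (betaMoment α θ a b) := fun a b => by
    rw [lintegral_betaLaw hA hB, betaMoment, show 1 - α + (θ + α) = θ + 1 by ring]
  have hma : ∀ a b : ℕ, Measurable fun y : ℝ =>
      ENNReal.ofReal y ^ a * ENNReal.ofReal (1 - y) ^ b := fun a b => by fun_prop
  have hprod : ∀ (a b : ℕ) {l : ℕ} (n' : Fin l → ℕ),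
      ∫⁻ p, ENNReal.ofReal p.1 ^ a * ENNReal.ofReal (1 - p.1) ^ b *
        distinctSum (stickBreaking p.2) n'
        ∂((betaLaw (1 - α) (θ + α)).prod (stickLaw α (θ + α))) =
      ENNReal.ofReal (betaMoment α θ a b) * stickMoment α (θ + α) n' := fun a b l n' => by
    rw [lintegral_prod_mul (f := fun y => ENNReal.ofReal y ^ a * ENNReal.ofReal (1 - y) ^ b)
      (hma a b).aemeasurable (measurable_distinctSum n').aemeasurable, hbeta]
    rfl
  have hms : ∀ (a b : ℕ) {l : ℕ} (n' : Fin l → ℕ), Measurable fun p : ℝ × (ℕ → ℝ) =>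
      ENNReal.ofReal p.1 ^ a * ENNReal.ofReal (1 - p.1) ^ b *
        distinctSum (stickBreaking p.2) n' := fun a b l n' =>
    ((hma a b).comp measurable_fst).mul ((measurable_distinctSum n').comp measurable_snd)
  rw [stickMoment, ← map_consSeq, lintegral_map (measurable_distinctSum n) measurable_consSeq]
  have hrec : ∀ᵐ p ∂((betaLaw (1 - α) (θ + α)).prod (stickLaw α (θ + α))),
      distinctSum (stickBreaking (consSeq p)) n =
        ENNReal.ofReal p.1 ^ 0 * ENNReal.ofReal (1 - p.1) ^ (∑ q, n q) *
          distinctSum (stickBreaking p.2) n +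
        ∑ j, ENNReal.ofReal p.1 ^ n j * ENNReal.ofReal (1 - p.1) ^ (∑ q, n (j.succAbove q)) *
          distinctSum (stickBreaking p.2) (fun q => n (j.succAbove q)) := by
    have := Measure.quasiMeasurePreserving_fst (ν := stickLaw α (θ + α)).ae (ae_betaLaw hA hB)
    filter_upwards [this] with p hp
    rw [pow_zero, one_mul]
    exact distinctSum_succ hp.2.le (stickBreaking_consSeq_zero _ _)
      (stickBreaking_consSeq_succ _ _) n
  rw [lintegral_congr_ae hrec, lintegral_add_left (hms _ _ _),
    lintegral_finsetSum _ fun j _ => hms _ _ _, hprod]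
  simp_rw [hprod]

/-! ### The closed formula and its agreement with stick breaking -/

/-- The exchangeable partition probability function of the two-parameter Poisson-Dirichlet
process. -/
def eppf (α θ : ℝ) {Q : Type} [Fintype Q] (n : Q → ℕ) : ℝ :=
  (∏ i ∈ Finset.range (Fintype.card Q - 1), (θ + (i + 1) * α)) / rising (θ + 1) ((∑ q, n q) - 1) *
    ∏ q, rising (1 - α) (n q - 1)

theorem eppf_equiv {Q Q' : Type} [Fintype Q] [Fintype Q'] (e : Q ≃ Q') (α θ : ℝ) (n : Q' → ℕ) :
    eppf α θ (n ∘ e) = eppf α θ n := by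
  unfold eppf
  rw [Fintype.card_congr e, ← e.prod_comp (fun q => rising (1 - α) (n q - 1)),
    ← e.sum_comp n]
  rfl

theorem eppf_nonneg {α θ : ℝ} (h0 : 0 < α) (h1 : α < 1) (hθ : -α < θ) {Q : Type} [Fintype Q]
    (n : Q → ℕ) : 0 ≤ eppf α θ n := by
  have h2 : ∀ i : ℕ, 0 < θ + (i + 1) * α := stick_param_pos h0 hθ
  exact mul_nonneg (div_nonneg (Finset.prod_nonneg fun i _ => (h2 i).le)
    (rising_pos (by linarith) _).le)
    (Finset.prod_nonneg fun q _ => (rising_pos (by linarith) _).le)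

/-- The rising factorial from the beta moment cancels the denominator of the formula at θ + α and
supplies the missing first factor θ + α of the numerator. With no blocks both sides are 1. -/
theorem rising_mul_eppf {α θ : ℝ} (hθ : -α < θ) {k : ℕ} {n : Fin k → ℕ}
    (hn : ∀ q, 1 ≤ n q) : rising (θ + α) (∑ q, n q) * eppf α (θ + α) n =
      (∏ i ∈ Finset.range k, (θ + (i + 1) * α)) * ∏ q, rising (1 - α) (n q - 1) := by
  unfold eppf
  rw [← mul_assoc, Fintype.card_fin]
  congr 1
  cases k with
  | zero => simp
  | succ k =>
    obtain ⟨N, hN⟩ : ∃ N, ∑ q, n q = N + 1 := Nat.exists_eq_succ_of_ne_zero fun h => by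
      have := hn 0
      rw [Finset.sum_eq_zero_iff.1 h 0 (Finset.mem_univ _)] at this
      omega
    have h2 := (rising_pos (show 0 < θ + α + 1 by linarith) N).ne'
    rw [hN, rising_succ', Nat.add_sub_cancel, Nat.add_sub_cancel, Finset.prod_range_succ']
    field_simp
    rw [mul_comm]
    congr 1
    · refine Finset.prod_congr rfl fun i _ => ?_
      push_cast
      ring
    · push_cast
      ring

/-- The ratio on the right is the Chinese restaurant probability of opening a new table; the ratios
in `betaMoment_mul_eppf` are those of joining an existing one. -/
theorem betaMoment_zero_mul_eppf {α θ : ℝ} (h1 : α < 1) (hθ : -α < θ) {k : ℕ}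
    {n : Fin (k + 1) → ℕ} (hn : ∀ q, 1 ≤ n q) :
    betaMoment α θ 0 (∑ q, n q) * eppf α (θ + α) n =
      eppf α θ n * ((θ + (k + 1) * α) / (θ + ∑ q, (n q : ℝ))) := by
  obtain ⟨N, hN⟩ : ∃ N, ∑ q, n q = N + 1 := Nat.exists_eq_succ_of_ne_zero fun h => by
    have := hn 0
    rw [Finset.sum_eq_zero_iff.1 h 0 (Finset.mem_univ _)] at this
    omega
  have h2 := (rising_pos (show 0 < θ + 1 by linarith) N).ne'
  have h3 : θ + 1 + (N : ℝ) ≠ 0 := by have : (0 : ℝ) ≤ N := N.cast_nonneg; linarith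
  rw [← Nat.cast_sum, betaMoment, rising_zero, one_mul, div_mul_eq_mul_div, zero_add,
    rising_mul_eppf hθ hn, hN, rising_succ]
  unfold eppf
  rw [hN, Fintype.card_fin, Nat.add_sub_cancel, Nat.add_sub_cancel, Finset.prod_range_succ,
    Nat.cast_succ, show θ + ((N : ℝ) + 1) = θ + 1 + N by ring]
  field_simp
  simp only [mul_comm α]
  ring

theorem betaMoment_mul_eppf {α θ : ℝ} (h1 : α < 1) (hθ : -α < θ) {k : ℕ}
    {n : Fin (k + 1) → ℕ} (hn : ∀ q, 1 ≤ n q) (j : Fin (k + 1)) :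
    betaMoment α θ (n j) (∑ q, n (j.succAbove q)) *
        eppf α (θ + α) (fun q => n (j.succAbove q)) =
      eppf α θ n * ((n j - α) / (θ + ∑ q, (n q : ℝ))) := by
  have hsum : n j + ∑ q, n (j.succAbove q) = ∑ q, n q := (Fin.sum_univ_succAbove n j).symm
  obtain ⟨m, hm⟩ : ∃ m, n j = m + 1 := Nat.exists_eq_succ_of_ne_zero (by have := hn j; omega)
  obtain ⟨N, hN⟩ : ∃ N, ∑ q, n q = N + 1 := ⟨m + ∑ q, n (j.succAbove q), by omega⟩
  have h2 := (rising_pos (show 0 < θ + 1 by linarith) N).ne'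
  have h3 : θ + 1 + (N : ℝ) ≠ 0 := by have : (0 : ℝ) ≤ N := N.cast_nonneg; linarith
  have h4 := rising_mul_eppf hθ (n := fun q => n (j.succAbove q)) fun q => hn _
  rw [← Nat.cast_sum, betaMoment, div_mul_eq_mul_div, mul_assoc, h4, hsum, hN, rising_succ]
  unfold eppf
  rw [hN, Fintype.card_fin, Nat.add_sub_cancel, Nat.add_sub_cancel,
    Fin.prod_univ_succAbove (fun q => rising (1 - α) (n q - 1)) j, hm, rising_succ,
    Nat.add_sub_cancel, Nat.cast_succ, Nat.cast_succ, show θ + ((N : ℝ) + 1) = θ + 1 + N by ring]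
  field_simp
  ring

/-- After division by `eppf α θ n` the terms are the seating probabilities of the Chinese restaurant
process, which sum to 1. This is the same recursion as `stickMoment_succ`. -/
theorem eppf_succ {α θ : ℝ} (h1 : α < 1) (hθ : -α < θ) {k : ℕ}
    {n : Fin (k + 1) → ℕ} (hn : ∀ q, 1 ≤ n q) :
    eppf α θ n = betaMoment α θ 0 (∑ q, n q) * eppf α (θ + α) n +
      ∑ j, betaMoment α θ (n j) (∑ q, n (j.succAbove q)) *
        eppf α (θ + α) (fun q => n (j.succAbove q)) := by
  simp_rw [betaMoment_zero_mul_eppf h1 hθ hn, betaMoment_mul_eppf h1 hθ hn,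
    ← Finset.mul_sum, ← Finset.sum_div, Finset.sum_sub_distrib]
  have h3 : (0 : ℝ) < θ + ∑ q, (n q : ℝ) := by
    have : (1 : ℝ) ≤ ∑ q, (n q : ℝ) := by
      refine le_trans ?_ (Finset.single_le_sum (f := fun q => (n q : ℝ))
        (fun q _ => Nat.cast_nonneg _) (Finset.mem_univ 0))
      exact_mod_cast hn 0
    linarith
  simp only [Finset.sum_const, Finset.card_univ, Fintype.card_fin, nsmul_eq_mul]
  push_cast
  field_simp
  ring

theorem tendsto_prod_ratio {x c α : ℝ} (hx : 0 < x) (hc : 0 < c) (hα : 0 < α) :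
    Filter.Tendsto (fun m => ∏ i ∈ Finset.range m, (x + i * α) / (x + c + i * α))
      Filter.atTop (nhds 0) := by
  have hpos : ∀ i : ℕ, 0 < x + c + i * α := fun i => by positivity
  -- Since x + c + iα ≤ (x + c + α)(i + 1), each factor is at most 1 − K/(i + 1) ≤ exp(−K/(i + 1)),
  -- and the harmonic series diverges.
  set K := c / (x + c + α)
  have hK : 0 < K := by positivity
  have hle : ∀ i : ℕ, (x + i * α) / (x + c + i * α) ≤ Real.exp (-(K * (1 / (i + 1)))) := by
    intro i
    have h1 : (x + i * α) / (x + c + i * α) = -(c / (x + c + i * α)) + 1 := by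
      have := (hpos i).ne'
      field_simp
      ring
    have h2 : K * (1 / (i + 1)) ≤ c / (x + c + i * α) := by
      rw [mul_one_div, div_div]
      refine div_le_div_of_nonneg_left hc.le (hpos i) ?_
      have : (0 : ℝ) ≤ i := i.cast_nonneg
      nlinarith [mul_nonneg this hx.le, mul_nonneg this hc.le]
    rw [h1]
    exact (Real.add_one_le_exp _).trans (Real.exp_le_exp.2 (neg_le_neg h2))
  refine squeeze_zero (fun m => Finset.prod_nonneg fun i _ => by positivity)
    (fun m => (Finset.prod_le_prod (fun i _ => by positivity) fun i _ => hle i)) ?_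
  simp_rw [← Real.exp_sum, Finset.sum_neg_distrib, ← Finset.mul_sum]
  exact Real.tendsto_exp_neg_atTop_nhds_zero.comp
    (Real.tendsto_sum_range_one_div_nat_succ_atTop.const_mul_atTop hK)

theorem betaMoment_zero_nonneg {α θ : ℝ} (hα : α < 1) (hθ : -α < θ) (N : ℕ) :
    0 ≤ betaMoment α θ 0 N := by
  have h1 := rising_pos (show 0 < θ + α by linarith) N
  have h2 := rising_pos (show 0 < θ + 1 by linarith) (0 + N)
  unfold betaMoment
  rw [rising_zero]
  positivity

theorem betaMoment_zero_le {α θ : ℝ} (hα : α < 1) (hθ : -α < θ) {N : ℕ}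
    (hN : 1 ≤ N) : betaMoment α θ 0 N ≤ (θ + α) / (θ + 1) := by
  induction N, hN using Nat.le_induction with
  | base => simp [betaMoment, rising]
  | succ N hN ih =>
    have hN0 : (0 : ℝ) ≤ N := N.cast_nonneg
    have h2 := (rising_pos (show 0 < θ + 1 by linarith) N).ne'
    have h3 : 0 < θ + 1 + N := by linarith
    have : betaMoment α θ 0 (N + 1) = betaMoment α θ 0 N * ((θ + α + N) / (θ + 1 + N)) := by
      simp only [betaMoment, rising_zero, zero_add, one_mul, rising_succ]
      field_simp
    rw [this]
    refine (mul_le_of_le_one_right (betaMoment_zero_nonneg hα hθ N) ?_).trans ih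
    rw [div_le_one h3]
    linarith

/-- Both sides satisfy the same recursion. By induction the terms with fewer blocks agree, so the
difference at θ is a beta moment times the difference at θ + α. Iterating multiplies by a product
that tends to zero against the moment and against the formula, hence the difference vanishes. -/
theorem toReal_stickMoment_eq_eppf {α : ℝ} (h0 : 0 < α) (h1 : α < 1) (k : ℕ) :
    ∀ {θ : ℝ}, -α < θ → ∀ {n : Fin k → ℕ}, (∀ q, 1 ≤ n q) →
      (stickMoment α θ n).toReal = eppf α θ n := by
  induction k with
  | zero =>
    intro θ hθ n hn
    simp [stickMoment_fin_zero, eppf]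
  | succ k ih =>
    intro θ hθ n hn
    have hlt : ∀ {θ : ℝ}, -α < θ → -α < θ + α := fun h => by linarith
    have hne : ∀ {θ : ℝ}, -α < θ → ∀ {l : ℕ} {n : Fin l → ℕ}, (∀ q, 1 ≤ n q) →
        stickMoment α θ n ≠ ∞ := fun {θ} h {l n} hn =>
      ((stickMoment_fin_le_one h0 h1 h hn).trans_lt ENNReal.one_lt_top).ne
    set N := ∑ q, n q with hN
    have hN1 : k + 1 ≤ N := by
      have := Finset.sum_le_sum fun q (_ : q ∈ Finset.univ) => hn q
      simpa using this
    have hN1' : (k : ℝ) + 1 ≤ N := by exact_mod_cast hN1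
    have hstep : ∀ {θ : ℝ}, -α < θ → (stickMoment α θ n).toReal - eppf α θ n =
        betaMoment α θ 0 N * ((stickMoment α (θ + α) n).toReal - eppf α (θ + α) n) := by
      intro θ hθ
      have hb : ∀ j, 0 ≤ betaMoment α θ (n j) (∑ q, n (j.succAbove q)) := fun j => by
        have h2 := rising_pos (show 0 < θ + α by linarith) (∑ q, n (j.succAbove q))
        have h3 := rising_pos (show 0 < θ + 1 by linarith) (n j + ∑ q, n (j.succAbove q))
        have h4 := rising_pos (show 0 < 1 - α by linarith) (n j)
        unfold betaMoment
        positivity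
      rw [stickMoment_succ h1 hθ, eppf_succ h1 hθ hn, ENNReal.toReal_add, ENNReal.toReal_mul,
        ENNReal.toReal_ofReal (betaMoment_zero_nonneg h1 hθ _), ENNReal.toReal_sum]
      · simp_rw [ENNReal.toReal_mul, ENNReal.toReal_ofReal (hb _)]
        have hj : ∀ j, (stickMoment α (θ + α) fun q => n (Fin.succAbove j q)).toReal =
            eppf α (θ + α) fun q => n (Fin.succAbove j q) := fun j => ih (hlt hθ) fun q => hn _
        simp_rw [hj, ← hN]
        ring
      · exact fun j _ => ENNReal.mul_ne_top ENNReal.ofReal_ne_top (hne (hlt hθ) fun q => hn _)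
      · exact ENNReal.mul_ne_top ENNReal.ofReal_ne_top (hne (hlt hθ) hn)
      · exact (ENNReal.sum_lt_top.2 fun j _ => (ENNReal.mul_lt_top ENNReal.ofReal_lt_top
          (hne (hlt hθ) fun q => hn _).lt_top)).ne
    have hθm : ∀ m : ℕ, -α < θ + m * α := fun m => by
      have : 0 ≤ m * α := by positivity
      linarith
    -- After m iterations, the coefficients in front of the moment, which is at most 1, are bounded
    -- by `betaMoment_zero_le`. For the formula no bound is needed: the product telescopes exactly
    -- through `betaMoment_zero_mul_eppf`.
    have hbound : ∀ m : ℕ, |(stickMoment α θ n).toReal - eppf α θ n| ≤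
        (∏ i ∈ Finset.range m, (θ + α + i * α) / (θ + α + (1 - α) + i * α)) *
          (stickMoment α (θ + m * α) n).toReal +
        eppf α θ n * ∏ i ∈ Finset.range m,
          (θ + (k + 1) * α + i * α) / (θ + (k + 1) * α + (N - (k + 1) * α) + i * α) := by
      intro m
      have hit : |(stickMoment α θ n).toReal - eppf α θ n| ≤
          (∏ i ∈ Finset.range m, betaMoment α (θ + i * α) 0 N) *
            (stickMoment α (θ + m * α) n).toReal +
          (∏ i ∈ Finset.range m, betaMoment α (θ + i * α) 0 N) * eppf α (θ + m * α) n := by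
        rw [← mul_add]
        have : (stickMoment α θ n).toReal - eppf α θ n =
            (∏ i ∈ Finset.range m, betaMoment α (θ + i * α) 0 N) *
            ((stickMoment α (θ + m * α) n).toReal - eppf α (θ + m * α) n) := by
          induction m with
          | zero => simp
          | succ m ihm =>
            rw [ihm, hstep (hθm m), Finset.prod_range_succ, Nat.cast_succ,
              show θ + m * α + α = θ + (m + 1) * α by ring]
            ring
        rw [this, abs_mul, abs_of_nonneg (Finset.prod_nonneg fun i _ =>
          betaMoment_zero_nonneg h1 (hθm i) N)]
        refine mul_le_mul_of_nonneg_left ?_ (Finset.prod_nonneg fun i _ =>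
          betaMoment_zero_nonneg h1 (hθm i) N)
        refine (abs_sub _ _).trans_eq ?_
        rw [abs_of_nonneg ENNReal.toReal_nonneg, abs_of_nonneg (eppf_nonneg h0 h1 (hθm m) n)]
      refine hit.trans (add_le_add (mul_le_mul_of_nonneg_right ?_ ENNReal.toReal_nonneg) ?_)
      · refine Finset.prod_le_prod (fun i _ => betaMoment_zero_nonneg h1 (hθm i) N) fun i _ => ?_
        refine (betaMoment_zero_le h1 (hθm i) (by omega)).trans_eq ?_
        congr 1 <;> ring
      · refine le_of_eq ?_
        clear hit
        induction m with
        | zero => simp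
        | succ m ihm =>
          rw [Finset.prod_range_succ, Finset.prod_range_succ, ← mul_assoc (eppf α θ n), ← ihm,
            mul_assoc, Nat.cast_succ, show θ + (m + 1) * α = θ + m * α + α by ring, hN,
            betaMoment_zero_mul_eppf h1 (hθm m) hn, ← mul_assoc, ← Nat.cast_sum]
          congr 2 <;> ring
    -- Blocks are nonempty, so N ≥ k + 1 > (k + 1)α; this is the positive gap c in the second
    -- product.
    have hk1 : (k + 1) * α < N := by
      have : (0 : ℝ) ≤ k := k.cast_nonneg
      nlinarith
    have hl1 := tendsto_prod_ratio (x := θ + α) (c := 1 - α) (by linarith) (by linarith) h0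
    have hl2 := tendsto_prod_ratio (x := θ + (k + 1) * α) (c := N - (k + 1) * α)
      (stick_param_pos h0 hθ k) (by linarith) h0
    have hlim := (hl1.zero_mul_isBoundedUnder_le (g := fun m : ℕ =>
      (stickMoment α (θ + m * α) n).toReal) ⟨1, by
        simp only [Filter.eventually_map]
        refine Filter.Eventually.of_forall fun m => ?_
        simp only [Function.comp, Real.norm_eq_abs, abs_of_nonneg ENNReal.toReal_nonneg]
        exact ENNReal.toReal_le_of_le_ofReal zero_le_one
          (by simpa using stickMoment_fin_le_one h0 h1 (hθm m) hn)⟩).add (hl2.const_mul (eppf α θ n))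
    rw [mul_zero, add_zero] at hlim
    have := ge_of_tendsto' hlim hbound
    exact sub_eq_zero.1 (abs_nonpos_iff.1 this)

theorem stickMoment_eq_eppf {α θ : ℝ} (h0 : 0 < α) (h1 : α < 1) (hθ : -α < θ) {Q : Type}
    [Fintype Q] {n : Q → ℕ} (hn : ∀ q, 1 ≤ n q) :
    stickMoment α θ n = ENNReal.ofReal (eppf α θ n) := by
  let e := (Fintype.equivFin Q).symm
  have h2 : stickMoment α θ n = stickMoment α θ (n ∘ e) := by
    simp_rw [stickMoment, distinctSum_equiv]
  have hn' : ∀ q, 1 ≤ (n ∘ e) q := fun q => hn _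
  rw [h2, ← eppf_equiv e, ← toReal_stickMoment_eq_eppf h0 h1 _ hθ hn', ENNReal.ofReal_toReal]
  exact ((stickMoment_fin_le_one h0 h1 hθ hn').trans_lt ENNReal.one_lt_top).ne

/-- The case of one block of size 1: the formula gives 1, so the total length has mean 1, and being
at most 1 it equals 1 almost surely. -/
theorem ae_hasSum_stickBreaking {α θ : ℝ} (h0 : 0 < α) (h1 : α < 1) (hθ : -α < θ) :
    ∀ᵐ Y ∂(stickLaw α θ), HasSum (stickBreaking Y) 1 := by
  have hD : ∀ Y, distinctSum (stickBreaking Y) (fun _ : Fin 1 => 1) =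
      ∑' l, ENNReal.ofReal (stickBreaking Y l) := by
    intro Y
    unfold distinctSum
    let e : (Fin 1 ↪ ℕ) ≃ ℕ :=
      { toFun := fun ι => ι 0
        invFun := fun l => ⟨fun _ => l, fun a b _ => Subsingleton.elim a b⟩
        left_inv := fun ι => by ext q; rw [Subsingleton.elim q 0]; rfl
        right_inv := fun l => rfl }
    rw [← e.tsum_eq]
    refine tsum_congr fun ι => ?_
    simp [e]
  have hM : ∫⁻ Y, distinctSum (stickBreaking Y) (fun _ : Fin 1 => 1) ∂(stickLaw α θ) =
      ∫⁻ _, 1 ∂(stickLaw α θ) := by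
    have := stickMoment_eq_eppf h0 h1 hθ (n := fun _ : Fin 1 => 1) fun _ => le_rfl
    rw [stickMoment] at this
    rw [this]
    simp [eppf]
  have hle : (fun Y => distinctSum (stickBreaking Y) (fun _ : Fin 1 => 1)) ≤ᵐ[stickLaw α θ]
      fun _ => 1 := by
    filter_upwards [ae_stickLaw h0 h1 hθ] with Y hY
    rw [hD]
    exact tsum_stickBreaking_le_one hY
  have hae := ae_eq_of_ae_le_of_lintegral_le hle (by rw [hM]; simp) aemeasurable_const hM.ge
  filter_upwards [hae, ae_stickLaw h0 h1 hθ] with Y hY hpos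
  rw [hD] at hY
  have hs : ∑' l, ENNReal.ofReal (stickBreaking Y l) ≠ ∞ := by rw [hY]; simp
  have hsum : HasSum (fun l => (ENNReal.ofReal (stickBreaking Y l)).toReal)
      (∑' l, ENNReal.ofReal (stickBreaking Y l)).toReal := by
    rw [ENNReal.tsum_toReal_eq fun _ => ENNReal.ofReal_ne_top]
    exact ENNReal.hasSum_toReal hs
  rw [hY] at hsum
  simpa [ENNReal.toReal_ofReal (stickBreaking_pos hpos _).le] using hsum

/-! ### Expected densities of Poisson-Dirichlet graphons -/

instance {V : Type} [Finite V] : Finite (Setoid V) :=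
  Finite.of_injective (fun s : Setoid V => fun a b => s a b) fun _ _ h =>
    Setoid.ext fun a b => iff_of_eq (congrFun (congrFun h a) b)

instance {V : Type} [Finite V] : Fintype (Setoid V) := Fintype.ofFinite _

/-- The disjoint union of the fibers of a map. -/
def sigmaFiberEquiv {P Q : Type} (r : P → Q) : (Σ B, Fiber r B) ≃ P where
  toFun x := x.2.val
  invFun a := ⟨r a, a, rfl⟩
  left_inv := by rintro ⟨_, a, rfl⟩; rfl
  right_inv _ := rfl

theorem prod_fiber {P Q M : Type} [CommMonoid M] [Fintype P] [Fintype Q] (r : P → Q) (f : P → M) :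
    ∏ D, f D = ∏ B, ∏ D : Fiber r B, f D.val := by
  rw [← (sigmaFiberEquiv r).prod_comp, Fintype.prod_sigma]
  rfl

theorem sum_fiber {P Q M : Type} [AddCommMonoid M] [Fintype P] [Fintype Q] (r : P → Q)
    (f : P → M) : ∑ D, f D = ∑ B, ∑ D : Fiber r B, f D.val := by
  rw [← (sigmaFiberEquiv r).sum_comp, Fintype.sum_sigma]
  rfl

/-- The sizes of the fibers of a map. -/
def blockSize {V Q : Type} [Fintype V] (p : V → Q) (b : Q) : ℕ := Fintype.card (Fiber p b)

theorem one_le_blockSize {V Q : Type} [Fintype V] {p : V → Q} (hp : p.Surjective) (b : Q) :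
    1 ≤ blockSize p b := by
  obtain ⟨a, ha⟩ := hp b
  exact Fintype.card_pos_iff.2 ⟨⟨a, ha⟩⟩

theorem prod_comp_eq_prod_pow {V Q M : Type} [CommMonoid M] [Fintype V] [Fintype Q] (p : V → Q)
    (f : Q → M) : ∏ a, f (p a) = ∏ b, f b ^ blockSize p b := by
  rw [prod_fiber p]
  refine Finset.prod_congr rfl fun b _ => ?_
  rw [Finset.prod_congr rfl fun (a : Fiber p b) _ => by rw [a.prop], Finset.prod_const]
  rfl

/-- A coloring, given by the partition into color classes and the colors of the blocks. -/
def coloringOfBlocks (V : Type) (x : Σ s : Setoid V, (Blocks s ↪ ℕ)) : V → ℕ :=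
  x.2 ∘ toBlock x.1

theorem ker_coloringOfBlocks {V : Type} (s : Setoid V) (ι : Blocks s ↪ ℕ) :
    Setoid.ker (coloringOfBlocks V ⟨s, ι⟩) = s := by
  ext a b
  rw [Setoid.ker_def, ← toBlock_eq_iff]
  exact ι.injective.eq_iff

/-- A coloring is a partition together with distinct names for its blocks; this turns sums over
colorings into sums over partitions. -/
theorem coloringOfBlocks_bijective (V : Type) : (coloringOfBlocks V).Bijective := by
  constructor
  · rintro ⟨s, ι⟩ ⟨s', ι'⟩ h
    obtain rfl : s = s' := by rw [← ker_coloringOfBlocks s ι, h, ker_coloringOfBlocks]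
    congr 1
    ext b
    obtain ⟨a, rfl⟩ := toBlock_surjective s b
    exact congrFun h a
  · exact fun c => ⟨⟨Setoid.ker c, ⟨blockColor c, blockColor_injective c⟩⟩, rfl⟩

theorem tsum_coloring {V : Type} [Fintype V] {v : ℕ → ℝ} (hv : ∀ i, 0 ≤ v i)
    {f : Setoid V → ℝ} (hf : ∀ s, 0 ≤ f s) :
    ∑' c : V → ℕ, (∏ a, v (c a)) * f (Setoid.ker c) =
      (∑ s, ENNReal.ofReal (f s) * distinctSum v (blockSize (toBlock s))).toReal := by
  have h : ∑ s, ENNReal.ofReal (f s) * distinctSum v (blockSize (toBlock s)) =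
      ∑' c : V → ℕ, ENNReal.ofReal ((∏ a, v (c a)) * f (Setoid.ker c)) := by
    rw [← (Equiv.ofBijective _ (coloringOfBlocks_bijective V)).tsum_eq, ENNReal.tsum_sigma',
      tsum_fintype]
    refine Finset.sum_congr rfl fun s _ => ?_
    rw [distinctSum, ← ENNReal.tsum_mul_left]
    refine tsum_congr fun ι => ?_
    rw [Equiv.ofBijective_apply, ker_coloringOfBlocks, mul_comm,
      ENNReal.ofReal_mul (Finset.prod_nonneg fun a _ => hv _),
      ENNReal.ofReal_prod_of_nonneg fun a _ => hv _,
      ← prod_comp_eq_prod_pow (toBlock s) fun b => ENNReal.ofReal (v (ι b))]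
    rfl
  rw [h, ENNReal.tsum_toReal_eq fun _ => ENNReal.ofReal_ne_top]
  exact tsum_congr fun c => (ENNReal.toReal_ofReal
    (mul_nonneg (Finset.prod_nonneg fun a _ => hv _) (hf _))).symm

theorem meanDensity_poissonDirichlet_eq_integral (α θ : ℝ) (H C : RandomGraphon) {V : Type}
    [Fintype V] (F : SimpleGraph V) :
    meanDensity F (poissonDirichlet α θ H C) =
      ∫ Y, ∫ r, density F (blockGraphon (pdPoints Y) (fun i => C.graphon (r.1 i))
        (sampleGraph (H.graphon r.2.1) r.2.2.1 r.2.2.2)) ∂(decorationLaw H C) ∂(stickLaw α θ) := by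
  have hm : Measurable fun ω : (ℕ → ℝ) × (ℕ → C.Ω) × H.Ω × (ℕ → I) × (ℕ × ℕ → I) =>
      density F (blockGraphon (pdPoints ω.1) (fun i => C.graphon (ω.2.1 i))
        (sampleGraph (H.graphon ω.2.2.1) ω.2.2.2.1 ω.2.2.2.2)) :=
    (poissonDirichlet α θ H C).measurable_density F measurable_id
  have hint := integrable_of_mem_Icc (μ := (stickLaw α θ).prod (decorationLaw H C)) hm
    fun _ => density_mem F _
  exact integral_prod _ hint

theorem tsum_coloring_perm {V : Type} [Fintype V] (v : ℕ → ℝ) (τ : ℕ ≃ ℕ) (f : Setoid V → ℝ) :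
    ∑' c : V → ℕ, (∏ a, v (τ (c a))) * f (Setoid.ker c) =
      ∑' c : V → ℕ, (∏ a, v (c a)) * f (Setoid.ker c) := by
  symm
  rw [← (Equiv.arrowCongr (Equiv.refl V) τ).tsum_eq]
  refine tsum_congr fun c => ?_
  have hker : Setoid.ker ((Equiv.arrowCongr (Equiv.refl V) τ) c) = Setoid.ker c := by
    ext a b
    simp [Setoid.ker_def]
  rw [hker]
  rfl

/-- Ranking merely permutes the sticks, and the sum over colorings is invariant under permuting
colors, so the size-ordered points may be replaced by the sticks in their original order. -/
theorem integral_density_pdPoints {Y : ℕ → ℝ} (hY : ∀ l, Y l ∈ Ioo (0 : ℝ) 1)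
    (hsum : HasSum (stickBreaking Y) 1) (H C : RandomGraphon) {V : Type} [Fintype V]
    (F : SimpleGraph V) :
    ∫ r, density F (blockGraphon (pdPoints Y) (fun i => C.graphon (r.1 i))
        (sampleGraph (H.graphon r.2.1) r.2.2.1 r.2.2.2)) ∂(decorationLaw H C) =
      (∑ s : Setoid V, ENNReal.ofReal (partitionTerm H C F (toBlock s)) *
        distinctSum (stickBreaking Y) (blockSize (toBlock s))).toReal := by
  have hpos := stickBreaking_pos hY
  obtain ⟨τ, hτ⟩ := exists_perm_ranked hpos hsum.summable
  have hpd : pdPoints Y = stickBreaking Y ∘ τ := hτ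
  have hpos' : ∀ i, 0 < pdPoints Y i := fun i => by rw [hpd]; exact hpos _
  have hsum' : HasSum (pdPoints Y) 1 := by rw [hpd]; exact τ.hasSum_iff.2 hsum
  rw [← tsum_coloring (fun i => (hpos i).le) fun s => (partitionTerm_mem H C F (toBlock s)).1,
    integral_density_blockGraphon hpos' hsum', hpd]
  exact tsum_coloring_perm (stickBreaking Y) τ fun s => partitionTerm H C F (toBlock s)

theorem meanDensity_poissonDirichlet {α θ : ℝ} (h0 : 0 < α) (h1 : α < 1) (hθ : -α < θ)
    (H C : RandomGraphon) {V : Type} [Fintype V] (F : SimpleGraph V) :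
    meanDensity F (poissonDirichlet α θ H C) =
      ∑ s : Setoid V, eppf α θ (blockSize (toBlock s)) * partitionTerm H C F (toBlock s) := by
  have hT : ∀ s : Setoid V, 0 ≤ partitionTerm H C F (toBlock s) := fun s =>
    (partitionTerm_mem H C F _).1
  have hn : ∀ s : Setoid V, ∀ q, 1 ≤ blockSize (toBlock s) q := fun s =>
    one_le_blockSize (toBlock_surjective s)
  have hlin : ∫⁻ Y, ∑ s : Setoid V, ENNReal.ofReal (partitionTerm H C F (toBlock s)) *
      distinctSum (stickBreaking Y) (blockSize (toBlock s)) ∂(stickLaw α θ) =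
      ENNReal.ofReal (∑ s : Setoid V,
        eppf α θ (blockSize (toBlock s)) * partitionTerm H C F (toBlock s)) := by
    rw [lintegral_finsetSum _ fun s _ => (measurable_distinctSum _).const_mul _,
      ENNReal.ofReal_sum_of_nonneg fun s _ => mul_nonneg (eppf_nonneg h0 h1 hθ _) (hT s)]
    refine Finset.sum_congr rfl fun s _ => ?_
    rw [lintegral_const_mul _ (measurable_distinctSum _), mul_comm,
      ENNReal.ofReal_mul (eppf_nonneg h0 h1 hθ _), ← stickMoment_eq_eppf h0 h1 hθ (hn s)]
    rfl
  have hm : Measurable fun Y => ∑ s : Setoid V, ENNReal.ofReal (partitionTerm H C F (toBlock s)) *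
      distinctSum (stickBreaking Y) (blockSize (toBlock s)) :=
    Finset.measurable_sum _ fun s _ => (measurable_distinctSum _).const_mul _
  rw [meanDensity_poissonDirichlet_eq_integral]
  calc _ = ∫ Y, (∑ s : Setoid V, ENNReal.ofReal (partitionTerm H C F (toBlock s)) *
        distinctSum (stickBreaking Y) (blockSize (toBlock s))).toReal ∂(stickLaw α θ) := by
        refine integral_congr_ae ?_
        filter_upwards [ae_stickLaw h0 h1 hθ, ae_hasSum_stickBreaking h0 h1 hθ] with Y hY hsum
        exact integral_density_pdPoints hY hsum H C F
    _ = _ := by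
        rw [integral_toReal hm.aemeasurable, hlin, ENNReal.toReal_ofReal]
        · exact Finset.sum_nonneg fun s _ => mul_nonneg (eppf_nonneg h0 h1 hθ _) (hT s)
        · exact ae_lt_top hm (by rw [hlin]; exact ENNReal.ofReal_ne_top)

/-- The partition formula involves H and C only through expected densities, which are functions of
their laws. -/
theorem law_poissonDirichlet_congr {α θ : ℝ} (h0 : 0 < α) (h1 : α < 1) (hθ : -α < θ)
    {H H' C C' : RandomGraphon} (hH : H.law = H'.law) (hC : C.law = C'.law) :
    (poissonDirichlet α θ H C).law = (poissonDirichlet α θ H' C').law := by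
  refine law_eq_of_meanDensity_eq fun F => ?_
  rw [meanDensity_poissonDirichlet h0 h1 hθ, meanDensity_poissonDirichlet h0 h1 hθ]
  refine Finset.sum_congr rfl fun s _ => ?_
  unfold partitionTerm
  simp_rw [meanDensity_eq_of_law_eq _ hH, meanDensity_eq_of_law_eq _ hC]

/-! ### Duality of fragmentation and coagulation -/

theorem prod_affine_eq_pow_mul (a x : ℝ) (m : ℕ) :
    ∏ i ∈ Finset.range m, a * (x + 1 + i) = a ^ m * rising (x + 1) m := by
  rw [Finset.prod_mul_distrib, Finset.prod_const, Finset.card_range, rising]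

theorem sum_card_fiber_sub_one {P Q : Type} [Fintype P] [Fintype Q] {r : P → Q}
    (hr : r.Surjective) :
    Fintype.card P - 1 = (Fintype.card Q - 1) + ∑ B, (blockSize r B - 1) := by
  have h1 : Fintype.card P = ∑ B, blockSize r B := by
    have := sum_fiber r fun _ => 1
    simpa [blockSize] using this
  have h2 : ∑ B, blockSize r B = ∑ B, (blockSize r B - 1) + Fintype.card Q := by
    rw [Fintype.card_eq_sum_ones, ← Finset.sum_add_distrib]
    exact Finset.sum_congr rfl fun B _ => (Nat.sub_add_cancel (one_le_blockSize hr B)).symm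
  -- Truncated subtraction makes the empty case separate: there every term is 0.
  rcases Nat.eq_zero_or_pos (Fintype.card Q) with h | h
  · have : IsEmpty Q := Fintype.card_eq_zero_iff.1 h
    have : IsEmpty P := r.isEmpty
    simp
  · omega

/-- Left: a partition into the fibers of r with parameters (αβ, θ), each fiber then fragmented with
(α, −αβ). Right: the fine partition with (α, θ), its blocks then merged with (β, θ/α). On the left
the denominators of the fragmentation cancel the block factors of the coarse partition; on the right
the numerator of the fine partition cancels the denominator of the merging. The powers of α match
because |P| − 1 = (|Q| − 1) + Σ_B (|r⁻¹(B)| − 1). -/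
theorem eppf_fragmentation {α β θ : ℝ} (h0 : 0 < α) (h1 : α < 1) (hβ1 : β < 1)
    (hθ : -(α * β) < θ) {P Q : Type} [Fintype P] [Fintype Q] {r : P → Q} (hr : r.Surjective)
    (n : P → ℕ) :
    eppf (α * β) θ (fun B => ∑ D : Fiber r B, n D.val) *
        ∏ B, eppf α (-(α * β)) (fun D : Fiber r B => n D.val) =
      eppf α θ n * eppf β (θ / α) (blockSize r) := by
  have hab : α * β < 1 := by nlinarith
  have hθ' : 0 < θ / α + 1 := by
    have : -1 < θ / α := by
      rw [lt_div_iff₀ h0]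
      nlinarith
    linarith
  -- The three numerators, with α extracted from each factor so that the cancelling rising
  -- factorials become visible.
  have ha : ∀ m, ∏ i ∈ Finset.range m, (-(α * β) + ((i : ℝ) + 1) * α) =
      α ^ m * rising (1 - β) m := fun m => by
    rw [show 1 - β = -β + 1 by ring, ← prod_affine_eq_pow_mul]
    exact Finset.prod_congr rfl fun i _ => by ring
  have hb : ∀ m, ∏ i ∈ Finset.range m, (θ + ((i : ℝ) + 1) * α) =
      α ^ m * rising (θ / α + 1) m := fun m => by
    rw [← prod_affine_eq_pow_mul]
    exact Finset.prod_congr rfl fun i _ => by field_simp; ring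
  have hc : ∀ m, ∏ i ∈ Finset.range m, (θ + ((i : ℝ) + 1) * (α * β)) =
      α ^ m * ∏ i ∈ Finset.range m, (θ / α + ((i : ℝ) + 1) * β) := fun m => by
    rw [← Finset.card_range m, ← Finset.prod_const, Finset.card_range, ← Finset.prod_mul_distrib]
    exact Finset.prod_congr rfl fun i _ => by field_simp
  have hcard : ∀ B, Fintype.card (Fiber r B) = blockSize r B := fun _ => rfl
  have hr1 := (rising_pos hθ' (Fintype.card P - 1)).ne'
  have hr2 : ∀ m, rising (1 - α * β) m ≠ 0 := fun m => (rising_pos (by linarith) m).ne'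
  have hsum : Fintype.card P = ∑ B, blockSize r B := by
    have := sum_fiber r fun _ => 1
    simpa [blockSize] using this
  have hfrag : ∏ B, eppf α (-(α * β)) (fun D : Fiber r B => n D.val) =
      α ^ (∑ B, (blockSize r B - 1)) * (∏ B, rising (1 - β) (blockSize r B - 1)) *
        (∏ D, rising (1 - α) (n D - 1)) /
        ∏ B, rising (1 - α * β) (∑ D : Fiber r B, n D.val - 1) := by
    rw [prod_fiber r fun D => rising (1 - α) (n D - 1), ← Finset.prod_pow_eq_pow_sum,
      ← Finset.prod_mul_distrib, ← Finset.prod_mul_distrib, ← Finset.prod_div_distrib]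
    refine Finset.prod_congr rfl fun B _ => ?_
    rw [eppf, hcard, ha, show -(α * β) + 1 = 1 - α * β by ring]
    ring
  have hr3 : ∏ B, rising (1 - α * β) (∑ D : Fiber r B, n D.val - 1) ≠ 0 :=
    Finset.prod_ne_zero_iff.2 fun B _ => hr2 _
  rw [hfrag]
  unfold eppf
  rw [hb, hc, ← hsum, ← sum_fiber r n, sum_card_fiber_sub_one hr, pow_add]
  rw [sum_card_fiber_sub_one hr] at hr1
  generalize rising (θ / α + 1) (Fintype.card Q - 1 + ∑ B, (blockSize r B - 1)) = x1 at *
  generalize ∏ i ∈ Finset.range (Fintype.card Q - 1), (θ / α + ((i : ℝ) + 1) * β) = x2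
  generalize ∏ B, rising (1 - α * β) (∑ D : Fiber r B, n D.val - 1) = x3 at *
  field_simp

/-! ### Nested partitions and the associativity law -/

/-- The contribution of a partition of the vertices to the expected density of a
Poisson-Dirichlet graphon. -/
def pdTerm (α θ : ℝ) (H C : RandomGraphon) {V Q : Type} [Fintype V] [Fintype Q]
    (F : SimpleGraph V) (p : V → Q) : ℝ :=
  eppf α θ (blockSize p) * partitionTerm H C F p

theorem blockSize_equiv_comp {V Q Q' : Type} [Fintype V] (e : Q ≃ Q') (p : V → Q) :
    blockSize (e ∘ p) ∘ e = blockSize p := by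
  funext b
  exact Fintype.card_congr
    { toFun := fun a => ⟨a.val, e.injective a.prop⟩
      invFun := fun a => ⟨a.val, congrArg e a.prop⟩
      left_inv := fun _ => rfl
      right_inv := fun _ => rfl }

theorem map_comp_graph {V P Q : Type} (F : SimpleGraph V) (p : V → P) (r : P → Q) :
    F.map (r ∘ p) = (F.map p).map r := by
  ext a b
  constructor
  · rintro ⟨hne, x, y, hxy, rfl, rfl⟩
    exact ⟨hne, p x, p y, ⟨fun h => hne (congrArg r h), x, y, hxy, rfl, rfl⟩, rfl, rfl⟩
  · rintro ⟨hne, _, _, ⟨-, x, y, hxy, rfl, rfl⟩, rfl, rfl⟩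
    exact ⟨hne, x, y, hxy, rfl, rfl⟩

theorem pdTerm_equiv_comp (α θ : ℝ) (H C : RandomGraphon) {V Q Q' : Type} [Fintype V] [Fintype Q]
    [Fintype Q'] (F : SimpleGraph V) (e : Q ≃ Q') (p : V → Q) :
    pdTerm α θ H C F (e ∘ p) = pdTerm α θ H C F p := by
  unfold pdTerm partitionTerm
  rw [← eppf_equiv e, blockSize_equiv_comp, ← e.prod_comp]
  congr 2
  · refine Finset.prod_congr rfl fun b _ => (meanDensity_iso ?_ C).symm
    exact
      { toFun := fun a => ⟨a.val, congrArg e a.prop⟩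
        invFun := fun a => ⟨a.val, e.injective a.prop⟩
        left_inv := fun _ => rfl
        right_inv := fun _ => rfl
        map_rel_iff' := Iff.rfl }
  · rw [map_comp_graph]
    exact (meanDensity_iso (SimpleGraph.Iso.map e (F.map p)) H).symm

/-- Only the partition into fibers matters, not how its blocks are represented. This identifies
partitions of a quotient or of a fiber with maps between quotients of V. -/
theorem pdTerm_congr (α θ : ℝ) (H C : RandomGraphon) {V Q Q' : Type} [Fintype V] [Fintype Q]
    [Fintype Q'] (F : SimpleGraph V) {p : V → Q} {p' : V → Q'} (hp : p.Surjective)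
    (hp' : p'.Surjective) (h : ∀ x y, p x = p y ↔ p' x = p' y) :
    pdTerm α θ H C F p = pdTerm α θ H C F p' := by
  have hs : ∀ x, p (Function.surjInv hp (p x)) = p x := fun x => Function.surjInv_eq hp _
  have hs' : ∀ x, p' (Function.surjInv hp' (p' x)) = p' x := fun x => Function.surjInv_eq hp' _
  let e : Q ≃ Q' :=
    { toFun := fun b => p' (Function.surjInv hp b)
      invFun := fun b => p (Function.surjInv hp' b)
      left_inv := fun b => by
        obtain ⟨x, rfl⟩ := hp b
        exact (h _ x).2 ((hs' _).trans ((h _ _).1 (hs x)))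
      right_inv := fun b => by
        obtain ⟨x, rfl⟩ := hp' b
        exact (h _ x).1 ((hs _).trans ((h _ _).2 (hs' x))) }
  rw [← pdTerm_equiv_comp α θ H C F e p]
  congr 1
  funext x
  exact (h _ _).1 (hs x)

/-- The restriction of a map to a fiber of a composition. -/
def fiberMap {V P Q : Type} (p : V → P) (r : P → Q) (B : Q) (x : Fiber (r ∘ p) B) : Fiber r B :=
  ⟨p x.val, x.prop⟩

theorem fiberMap_surjective {V P Q : Type} {p : V → P} (hp : p.Surjective) (r : P → Q) (B : Q) :
    (fiberMap p r B).Surjective := by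
  rintro ⟨D, hD⟩
  obtain ⟨x, rfl⟩ := hp D
  exact ⟨⟨x, hD⟩, rfl⟩

/-- The fiber of `fiberMap` is a fiber of the original map. -/
def fiberFiberMapEquiv {V P Q : Type} (p : V → P) (r : P → Q) (B : Q) (D : Fiber r B) :
    Fiber (fiberMap p r B) D ≃ Fiber p D.val where
  toFun x := ⟨x.val.val, congrArg Fiber.val x.prop⟩
  invFun x := ⟨⟨x.val, (congrArg r x.prop).trans D.prop⟩, Fiber.ext x.prop⟩
  left_inv _ := rfl
  right_inv _ := rfl

/-- For a fixed nested pair both expansions contain the same densities: C on the fine blocks, B on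
each coarse block with its fine blocks contracted, A on F contracted to coarse blocks. For B this
needs that contraction commutes with restriction to a coarse block (`hquot`). What remains is
`eppf_fragmentation`. -/
theorem pdTerm_comp {α β θ : ℝ} (h0 : 0 < α) (h1 : α < 1) (hβ1 : β < 1)
    (hθ : -(α * β) < θ) (A B C : RandomGraphon) {V P Q : Type} [Fintype V] [Fintype P] [Fintype Q]
    (F : SimpleGraph V) {p : V → P} {r : P → Q} (hr : r.Surjective) :
    eppf (α * β) θ (blockSize (r ∘ p)) * ((∏ b, pdTerm α (-(α * β)) B C (fiberGraph (r ∘ p) b F)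
      (fiberMap p r b)) * meanDensity (F.map (r ∘ p)) A) =
    eppf α θ (blockSize p) * ((∏ D, meanDensity (fiberGraph p D F) C) *
      pdTerm β (θ / α) A B (F.map p) r) := by
  have hsize : blockSize (r ∘ p) = fun b => ∑ D : Fiber r b, blockSize p D.val := by
    funext b
    have : blockSize (r ∘ p) b = ∑ D, blockSize (fiberMap p r b) D := by
      have := sum_fiber (fiberMap p r b) fun _ => 1
      simpa [blockSize] using this
    rw [this]
    exact Finset.sum_congr rfl fun D _ => Fintype.card_congr (fiberFiberMapEquiv p r b D)
  have hsize' : ∀ b, blockSize (fiberMap p r b) = fun D : Fiber r b => blockSize p D.val :=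
    fun b => funext fun D => Fintype.card_congr (fiberFiberMapEquiv p r b D)
  have hquot : ∀ b, (fiberGraph (r ∘ p) b F).map (fiberMap p r b) = fiberGraph r b (F.map p) := by
    intro b
    ext D D'
    constructor
    · rintro ⟨hne, x, y, hxy, rfl, rfl⟩
      exact ⟨fun h => hne (Fiber.ext h), x.val, y.val, hxy, rfl, rfl⟩
    · rintro ⟨hne, x, y, hxy, hx, hy⟩
      refine ⟨fun h => hne (congrArg Fiber.val h), ⟨x, ?_⟩, ⟨y, ?_⟩, hxy, Fiber.ext hx, Fiber.ext hy⟩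
      · exact (congrArg r hx).trans D.prop
      · exact (congrArg r hy).trans D'.prop
  have hC : ∀ b (D : Fiber r b), meanDensity (fiberGraph (fiberMap p r b) D
      (fiberGraph (r ∘ p) b F)) C = meanDensity (fiberGraph p D.val F) C := fun b D =>
    meanDensity_iso { fiberFiberMapEquiv p r b D with map_rel_iff' := Iff.rfl } C
  have heppf := eppf_fragmentation h0 h1 hβ1 hθ hr (blockSize p)
  unfold pdTerm partitionTerm
  rw [hsize, map_comp_graph, prod_fiber r fun D => meanDensity (fiberGraph p D F) C]
  simp_rw [hsize', hquot, hC, Finset.prod_mul_distrib]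
  linear_combination (∏ b, ∏ D : Fiber r b, meanDensity (fiberGraph p D.val F) C) *
    (∏ b, meanDensity (fiberGraph r b (F.map p)) B) * meanDensity ((F.map p).map r) A * heppf

/-- The map from the blocks of a partition to the blocks of a coarser partition. -/
def coarsen {V : Type} {s t : Setoid V} (h : s ≤ t) : Blocks s → Blocks t :=
  Quotient.lift (toBlock t) fun _ _ hab => toBlock_eq_iff.2 (h hab)

theorem coarsen_surjective {V : Type} {s t : Setoid V} (h : s ≤ t) : (coarsen h).Surjective :=
  fun b => by
    obtain ⟨a, rfl⟩ := toBlock_surjective t b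
    exact ⟨toBlock s a, rfl⟩

/-- The refinements of a partition correspond to families of partitions of its blocks. -/
def restrictRefinement {V : Type} (t : Setoid V) (s : {s : Setoid V // s ≤ t}) (b : Blocks t) :
    Setoid (Fiber (toBlock t) b) := Setoid.comap Fiber.val s.1

/-- A family of partitions of the blocks is glued by labelling each element with its block and its
class within that block; the kernel of the labelling is the refinement. -/
theorem restrictRefinement_bijective {V : Type} (t : Setoid V) :
    (restrictRefinement t).Bijective := by
  constructor
  · have key : ∀ s s' : {s : Setoid V // s ≤ t}, restrictRefinement t s = restrictRefinement t s' →
        ∀ x y, s.1 x y → s'.1 x y := by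
      intro s s' h x y hxy
      have h1 := congrFun h (toBlock t y)
      have h2 : restrictRefinement t s (toBlock t y) ⟨x, toBlock_eq_iff.2 (s.2 hxy)⟩ ⟨y, rfl⟩ := hxy
      rw [h1] at h2
      exact h2
    exact fun s s' h => Subtype.ext (Setoid.ext fun x y => ⟨key s s' h x y, key s' s h.symm x y⟩)
  · intro f
    let g : V → Σ b, Blocks (f b) := fun x => ⟨toBlock t x, toBlock (f (toBlock t x)) ⟨x, rfl⟩⟩
    refine ⟨⟨Setoid.ker g, fun {x y} h => toBlock_eq_iff.1 (congrArg Sigma.fst h)⟩, ?_⟩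
    funext b
    ext ⟨x, hx⟩ ⟨y, rfl⟩
    have hg : ∀ (b) (x : Fiber (toBlock t) b), g x.val = ⟨b, toBlock (f b) x⟩ := by
      rintro _ ⟨x, rfl⟩
      rfl
    change g x = g y ↔ _
    rw [hg _ ⟨x, hx⟩, hg _ ⟨y, rfl⟩, Sigma.mk.injEq]
    simp [toBlock_eq_iff]

/-- The pairs of a partition and a refinement of it. -/
def refinementPairsEquiv (V : Type) :
    (Σ s : Setoid V, {t : Setoid V // s ≤ t}) ≃ Σ t : Setoid V, {s : Setoid V // s ≤ t} where
  toFun x := ⟨x.2.1, x.1, x.2.2⟩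
  invFun x := ⟨x.2.1, x.1, x.2.2⟩
  left_inv _ := rfl
  right_inv _ := rfl

instance {V : Type} [Finite V] (s : Setoid V) : Fintype {t : Setoid V // s ≤ t} :=
  Fintype.ofFinite _

instance {V : Type} [Finite V] (t : Setoid V) : Fintype {s : Setoid V // s ≤ t} :=
  Fintype.ofFinite _

/-- Partitions of the set of blocks of s correspond to coarsenings of s. -/
theorem sum_coarsenings {α θ : ℝ} (H C : RandomGraphon) {V : Type} [Fintype V] (s : Setoid V)
    (G : SimpleGraph (Blocks s)) :
    ∑ ρ : Setoid (Blocks s), pdTerm α θ H C G (toBlock ρ) =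
      ∑ t : {t : Setoid V // s ≤ t}, pdTerm α θ H C G (coarsen t.2) := by
  let e : {t : Setoid V // s ≤ t} ≃ Setoid (Blocks s) := (Setoid.correspondence s).toEquiv
  refine (Fintype.sum_equiv e _ _ fun t => ?_).symm
  refine pdTerm_congr α θ H C G (coarsen_surjective t.2) (toBlock_surjective _) fun x y => ?_
  obtain ⟨x, rfl⟩ := toBlock_surjective s x
  obtain ⟨y, rfl⟩ := toBlock_surjective s y
  rw [toBlock_eq_iff]
  exact toBlock_eq_iff

/-- Expanding the product selects a partition of every block of t, that is, a refinement of t. -/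
theorem prod_sum_refinements {α θ : ℝ} (H C : RandomGraphon) {V : Type} [Fintype V] (t : Setoid V)
    (F : SimpleGraph V) :
    ∏ b, ∑ ρ : Setoid (Fiber (toBlock t) b), pdTerm α θ H C (fiberGraph (toBlock t) b F)
        (toBlock ρ) =
      ∑ s : {s : Setoid V // s ≤ t}, ∏ b, pdTerm α θ H C (fiberGraph (toBlock t) b F)
        (fiberMap (toBlock s.1) (coarsen s.2) b) := by
  classical
  rw [Finset.prod_univ_sum, Fintype.piFinset_univ]
  refine (Fintype.sum_bijective _ (restrictRefinement_bijective t) _ _ fun s => ?_).symm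
  refine Finset.prod_congr rfl fun b _ => ?_
  refine pdTerm_congr α θ H C _ (fiberMap_surjective (toBlock_surjective _) (coarsen s.2) b)
    (toBlock_surjective _) fun x y => ?_
  rw [toBlock_eq_iff]
  exact Fiber.ext_iff.trans toBlock_eq_iff

/-- Iterated Poisson-Dirichlet graphons: fragmenting the blocks of a Poisson-Dirichlet graphon
amounts to coagulating the blocks of a finer one. -/
theorem law_poissonDirichlet_assoc {α β θ : ℝ} (h0 : 0 < α) (h1 : α < 1) (hβ0 : 0 < β)
    (hβ1 : β < 1) (hθ : -(α * β) < θ) (A B C : RandomGraphon) :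
    (poissonDirichlet (α * β) θ A (poissonDirichlet α (-(α * β)) B C)).law =
      (poissonDirichlet α θ (poissonDirichlet β (θ / α) A B) C).law := by
  have hab0 : 0 < α * β := mul_pos h0 hβ0
  have hab1 : α * β < 1 := by nlinarith
  have hθ1 : -α < -(α * β) := by nlinarith
  have hθ2 : -α < θ := hθ1.trans hθ
  have hθ3 : -β < θ / α := by
    rw [lt_div_iff₀ h0]
    linarith
  refine law_eq_of_meanDensity_eq fun ⟨k, F⟩ => ?_
  have hL : meanDensity F (poissonDirichlet (α * β) θ A (poissonDirichlet α (-(α * β)) B C)) =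
      ∑ t, ∑ s : {s : Setoid (Fin k) // s ≤ t}, eppf (α * β) θ (blockSize (toBlock t)) *
        ((∏ b, pdTerm α (-(α * β)) B C (fiberGraph (toBlock t) b F)
          (fiberMap (toBlock s.1) (coarsen s.2) b)) * meanDensity (F.map (toBlock t)) A) := by
    rw [meanDensity_poissonDirichlet hab0 hab1 hθ]
    refine Finset.sum_congr rfl fun t _ => ?_
    unfold partitionTerm
    simp_rw [meanDensity_poissonDirichlet h0 h1 hθ1]
    rw [← Finset.mul_sum, ← Finset.sum_mul, ← prod_sum_refinements]
    rfl
  have hR : meanDensity F (poissonDirichlet α θ (poissonDirichlet β (θ / α) A B) C) =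
      ∑ s, ∑ t : {t : Setoid (Fin k) // s ≤ t}, eppf α θ (blockSize (toBlock s)) *
        ((∏ D, meanDensity (fiberGraph (toBlock s) D F) C) *
          pdTerm β (θ / α) A B (F.map (toBlock s)) (coarsen t.2)) := by
    rw [meanDensity_poissonDirichlet h0 h1 hθ2]
    refine Finset.sum_congr rfl fun s _ => ?_
    unfold partitionTerm
    rw [meanDensity_poissonDirichlet hβ0 hβ1 hθ3, ← Finset.mul_sum, ← Finset.mul_sum,
      ← sum_coarsenings]
    rfl
  change meanDensity F _ = meanDensity F _
  rw [hL, hR, ← Fintype.sum_sigma', ← Fintype.sum_sigma']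
  -- Exchange of the order of summation over nested pairs, after which the terms are compared one by
  -- one.
  refine (Fintype.sum_equiv (refinementPairsEquiv (Fin k)) _ _ ?_).symm
  rintro ⟨s, t, hst⟩
  exact (pdTerm_comp h0 h1 hβ1 hθ A B C F (p := toBlock s) (coarsen_surjective hst)).symm

/-! ### Induction along the iterated limits -/

theorem law_iteratedLimit_succ (d : ℕ) :
    (iteratedLimit (d + 2)).law =
      (poissonDirichlet (1 / 2) (-(1 / 2) ^ (d + 2)) (iteratedLimit (d + 1)) brownian).law := by
  induction d with
  -- For the second limit both graphons inserted are Brownian and both parameters α are 1/2, so the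
  -- two descriptions coincide.
  | zero => simp [iteratedLimit]
  | succ d ih =>
    have hp : ∀ m : ℕ, (0 : ℝ) < (1 / 2) ^ m := fun m => by positivity
    have hp1 : ∀ m : ℕ, ((1 : ℝ) / 2) ^ (m + 1) < 1 := fun m =>
      pow_lt_one₀ (by norm_num) (by norm_num) (Nat.succ_ne_zero m)
    have hs : ∀ m : ℕ, ((1 : ℝ) / 2) ^ (m + 1) = 1 / 2 * (1 / 2) ^ m := fun m => pow_succ' _ _
    have h1 : (iteratedLimit (d + 1 + 2)).law =
        (poissonDirichlet ((1 / 2) ^ (d + 2)) (-(1 / 2) ^ (d + 3)) brownian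
          (poissonDirichlet (1 / 2) (-(1 / 2) ^ (d + 2)) (iteratedLimit (d + 1)) brownian)).law :=
      law_poissonDirichlet_congr (hp _) (hp1 _)
        (by rw [hs (d + 2)]; linarith [hp (d + 2)]) rfl ih
    -- Here αβ = 2^{-(d+2)} matches both the outer α and minus the inner θ, and θ/α = −2^{-(d+2)}.
    -- Hence the new H, with parameters (β, θ/α), is by definition `iteratedLimit (d + 2)`.
    have h2 := law_poissonDirichlet_assoc (α := 1 / 2) (β := (1 / 2) ^ (d + 1))
      (θ := -(1 / 2) ^ (d + 3)) (by norm_num) (by norm_num) (hp _) (hp1 _)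
      (by rw [← hs, hs (d + 2)]; linarith [hp (d + 2)]) brownian (iteratedLimit (d + 1)) brownian
    have h3 : -((1 : ℝ) / 2) ^ (d + 3) / (1 / 2) = -(1 / 2) ^ (d + 2) := by
      rw [hs (d + 2)]; ring
    rw [← hs, h3] at h2
    exact h1.trans h2

end PDGraphon

theorem mainTheorem8 (d : ℕ) (hd : 2 ≤ d) (H C : PDGraphon.RandomGraphon)
    (hH : H.law = (PDGraphon.iteratedLimit (d - 1)).law)
    (hC : C.law = PDGraphon.brownian.law) :
    (PDGraphon.iteratedLimit d).law =
      (PDGraphon.poissonDirichlet (1 / 2) (-(1 / 2) ^ d) H C).law := by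
  obtain ⟨d, rfl⟩ : ∃ m, d = m + 2 := ⟨d - 2, by omega⟩
  rw [PDGraphon.law_iteratedLimit_succ]
  -- This is the condition θ > −α; for the first limit it would degenerate to an equality.
  have h : ((1 : ℝ) / 2) ^ (d + 2) < 1 / 2 := by
    have h1 : ((1 : ℝ) / 2) ^ (d + 1) < 1 :=
      pow_lt_one₀ (by norm_num) (by norm_num) (Nat.succ_ne_zero d)
    rw [pow_succ']
    linarith
  exact PDGraphon.law_poissonDirichlet_congr (by norm_num) (by norm_num) (by linarith)
    hH.symm hC.symm

end
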